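/- Let $\ell\ge 1$ be a fixed integer, and for $n\in\mathbb{N}$ let $d_{n,\ell}$ be the number of permutations of $n$ symbols all of whose cycles have length at most $\ell$ (a fixed point being a cycle of length $1$). For $1\le k\le \ell-1$ let $$c_{k,\ell}=\frac{\left(\frac{k}{\ell}+1\right)\left(\frac{k}{\ell}+2\right)\cdots\left(\frac{k}{\ell}+k-1\right)}{k!\,(\ell-k)}\in\mathbb{Q},$$ where the product in the numerator is empty (equal to $1$) for $k=1$. Then, as $n\to\infty$, $$d_{n,\ell}\sim \frac{1}{\sqrt{\ell}}\,n^{\,n(1-1/\ell)}\exp\left(-\frac1\ell\sum_{j=2}^{\ell}\frac1j-n+\frac{n}{\ell}+\sum_{k=1}^{\ell-1}c_{k,\ell}\,n^{(\ell-k)/\ell}\right),$$ that is, the quotient of the two sides tends to $1$. -/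

import Mathlib

open Filter Asymptotics

/-- `C_{n,ℓ}`: the permutations of `n` points all of whose cycles have length at most `ℓ`.
`π.partition.parts` is the multiset of all cycle lengths of `π`, a fixed point being a cycle of
length `1`. -/
def boundedCyclePerms (n ℓ : ℕ) : Set (Equiv.Perm (Fin n)) :=
  {π | ∀ m ∈ π.partition.parts, m ≤ ℓ}

/-- `d_{n,ℓ} = # C_{n,ℓ}`. -/
noncomputable def numBoundedCyclePerms (n ℓ : ℕ) : ℕ :=
  (boundedCyclePerms n ℓ).ncard

/-- The rational coefficient
`c_{k,ℓ} = (k/ℓ + 1) (k/ℓ + 2) ⋯ (k/ℓ + k - 1) / (k! (ℓ - k))`, for `1 ≤ k < ℓ`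
(the product is empty for `k = 1`). -/
def saddleCoeff (k ℓ : ℕ) : ℚ :=
  (∏ i ∈ Finset.Ico 1 k, ((k : ℚ) / (ℓ : ℚ) + (i : ℚ))) /
    ((Nat.factorial k : ℚ) * ((ℓ : ℚ) - (k : ℚ)))

/-! Divided by $n!$, the count is the coefficient of $z^n$ in $e^{P(z)}$, where
$P(z)=\sum_{j\le\ell}z^j/j$. No formal power series are needed: the sums over cycle types and the
Cauchy integrals obey the same recurrence (`boundedCycleCoeff_rec`, `circleIntegral_exp_cyclePoly`).

The circle gets the radius $r$ with $r+\dots+r^\ell=n$, where $P(z)-n\log z$ is stationary. With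
$B=\sum_j j r^j$, the substitution $\theta=s/\sqrt B$ makes the integral Gaussian, so the
coefficient is asymptotic to $e^{P(r)}r^{-n}/\sqrt{2\pi B}$ (`tendsto_boundedCycleCoeff_saddle`).
Since $B\sim\ell n$, the square roots here and in Stirling's formula leave $1/\sqrt\ell$.

It remains to expand $P(r)-n\log r$ in $n$ up to $o(1)$, without solving for $r$. Put $w=1/r$ and
$S=1+w+\dots+w^{\ell-1}$, so that $n=w^{-\ell}S$. The error of the expansion is $w^{-\ell}$ times a
function of $w$ that must be known up to $o(w^\ell)$, and to that accuracy $S$ may be replaced by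
$1/(1-w)$. Then $n^{-1/\ell}$ becomes $u=w(1-w)^{1/\ell}$, and $(\ell-k)c_{k,\ell}$ is the
coefficient of $u^k$ in $-\log(1-w)$. Lagrange inversion identities cancel all orders below
$w^\ell$, and order $\ell$ leaves the constant $-(H_\ell-1)/\ell$ (`truncated_scaledExponent`,
`tendsto_exponent`). -/

/-! ### Counting by cycle type, and the recurrence. -/

/-- The reciprocal of the order of the centralizer of a permutation with cycle lengths `s`. -/
noncomputable def cycleWeight (s : Multiset ℕ) : ℝ :=
  1 / ((s.prod : ℝ) * ∏ i ∈ s.toFinset, ((s.count i).factorial : ℝ))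

/-- The multisets of positive integers of size at most `ℓ` with sum `n`. -/
def boundedPartitions (ℓ n : ℕ) : Finset (Multiset ℕ) :=
  ((Finset.univ : Finset n.Partition).image Nat.Partition.parts).filter (fun s => ∀ m ∈ s, m ≤ ℓ)

theorem mem_boundedPartitions {ℓ n : ℕ} {s : Multiset ℕ} :
    s ∈ boundedPartitions ℓ n ↔ (s.sum = n ∧ ∀ m ∈ s, 0 < m) ∧ ∀ m ∈ s, m ≤ ℓ := by
  simp only [boundedPartitions, Finset.mem_filter, Finset.mem_image, Finset.mem_univ, true_and]
  refine and_congr_left fun _ => ⟨?_, ?_⟩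
  · rintro ⟨p, rfl⟩
    exact ⟨p.parts_sum, fun m hm => p.parts_pos hm⟩
  · rintro ⟨h1, h2⟩
    exact ⟨⟨s, fun {i} hi => h2 i hi, h1⟩, rfl⟩

theorem eq_filter_add_replicate {s : Multiset ℕ} (hs : ∀ m ∈ s, 0 < m) :
    s = s.filter (fun m => 2 ≤ m) + Multiset.replicate (s.count 1) 1 := by
  conv_lhs => rw [← Multiset.filter_add_not (fun m => 2 ≤ m) s]
  congr 1
  rw [← Multiset.filter_eq]
  refine Multiset.filter_congr fun m hm => ?_
  have := hs m hm
  omega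

/-- This is the centralizer formula for `cycleType`, which omits fixed points. Restoring them as
parts equal to 1 does not change the product of the parts, and adds to the product of factorials
exactly the factor that counts permutations of the fixed points. -/
theorem card_partition_eq {α : Type*} [DecidableEq α] [Fintype α] {s : Multiset ℕ}
    (hs : ∀ m ∈ s, 0 < m) (hsum : s.sum = Fintype.card α) :
    ((Finset.univ.filter (fun σ : Equiv.Perm α => σ.partition.parts = s)).card : ℝ) =
      (Fintype.card α).factorial * cycleWeight s := by
  set m := s.filter (fun m => 2 ≤ m) with hm
  have hsplit := eq_filter_add_replicate hs
  rw [← hm] at hsplit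
  have hmsum : Fintype.card α - m.sum = s.count 1 := by
    have : s.sum = m.sum + s.count 1 := by
      conv_lhs => rw [hsplit]
      simp
    omega
  have hmle : m.sum ≤ Fintype.card α := by
    have : s.sum = m.sum + s.count 1 := by
      conv_lhs => rw [hsplit]
      simp
    omega
  have hset : Finset.univ.filter (fun σ : Equiv.Perm α => σ.partition.parts = s) =
      Finset.univ.filter (fun σ : Equiv.Perm α => σ.cycleType = m) := by
    refine Finset.filter_congr fun σ _ => ⟨fun h => ?_, fun h => ?_⟩
    · rw [hm, ← h, Equiv.Perm.filter_parts_partition_eq_cycleType]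
    · rw [Equiv.Perm.parts_partition, ← Equiv.Perm.sum_cycleType, h, hmsum]
      exact hsplit.symm
  have key := Equiv.Perm.card_of_cycleType_mul_eq α m
  rw [if_pos ⟨hmle, fun a ha => (Multiset.mem_filter.1 ha).2⟩, hmsum] at key
  have hprod : s.prod = m.prod := by
    conv_lhs => rw [hsplit]
    simp
  have hfac : ∏ i ∈ s.toFinset, (s.count i).factorial =
      (s.count 1).factorial * ∏ i ∈ m.toFinset, (m.count i).factorial := by
    have h1 : (1 : ℕ) ∉ m.toFinset := by
      simp [hm]
    have hm' : ∀ i ∈ m.toFinset, m.count i = s.count i := by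
      intro i hi
      rw [Multiset.mem_toFinset, hm] at hi
      rw [hm, Multiset.count_filter_of_pos (Multiset.mem_filter.1 hi).2]
    have hcongr : ∏ i ∈ m.toFinset, (m.count i).factorial =
        ∏ i ∈ m.toFinset, (s.count i).factorial :=
      Finset.prod_congr rfl fun i hi => by rw [hm' i hi]
    rw [hcongr, ← Finset.prod_insert (f := fun i => (s.count i).factorial) h1]
    refine Finset.prod_subset (fun i hi => ?_) (fun i _ hi => ?_)
    · rw [Multiset.mem_toFinset] at hi
      rw [Finset.mem_insert, Multiset.mem_toFinset, hm, Multiset.mem_filter]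
      have := hs i hi
      by_cases h : i = 1
      · exact Or.inl h
      · exact Or.inr ⟨hi, by omega⟩
    · rw [Multiset.mem_toFinset] at hi
      rw [Multiset.count_eq_zero_of_notMem hi, Nat.factorial_zero]
  have hpos : 0 < s.prod := Multiset.prod_pos hs
  have hpos2 : 0 < ∏ i ∈ s.toFinset, (s.count i).factorial :=
    Finset.prod_pos fun i _ => Nat.factorial_pos _
  rw [hset, cycleWeight, mul_one_div, eq_div_iff (by exact_mod_cast (Nat.mul_pos hpos hpos2).ne')]
  rw [← key, hprod]
  push_cast
  have h3 : (∏ i ∈ s.toFinset, ((s.count i).factorial : ℝ)) =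
      (s.count 1).factorial * ∏ i ∈ m.toFinset, ((m.count i).factorial : ℝ) := by
    exact_mod_cast hfac
  rw [h3]
  ring

/-- The exponential generating coefficients of the permutations with cycles bounded by `ℓ`. -/
noncomputable def boundedCycleCoeff (ℓ n : ℕ) : ℝ :=
  ∑ s ∈ boundedPartitions ℓ n, cycleWeight s

theorem numBoundedCyclePerms_eq (n ℓ : ℕ) :
    (numBoundedCyclePerms n ℓ : ℝ) = n.factorial * boundedCycleCoeff ℓ n := by
  classical
  have h1 : boundedCyclePerms n ℓ = ((Finset.univ.filter
      (fun σ : Equiv.Perm (Fin n) => ∀ m ∈ σ.partition.parts, m ≤ ℓ) : Finset _) : Set _) := by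
    ext σ
    simp [boundedCyclePerms]
  rw [numBoundedCyclePerms, h1, Set.ncard_coe_finset, boundedCycleCoeff,
    Finset.card_eq_sum_card_fiberwise (f := fun σ => σ.partition.parts)
      (t := boundedPartitions ℓ n), Nat.cast_sum, Finset.mul_sum]
  · refine Finset.sum_congr rfl fun s hs => ?_
    rw [mem_boundedPartitions] at hs
    have := card_partition_eq (α := Fin n) hs.1.2 (by simpa using hs.1.1)
    have hcard : (Fintype.card (Fin n)).factorial = n.factorial := by rw [Fintype.card_fin]
    rw [hcard] at this
    rw [← this, Finset.filter_filter]
    congr 2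
    refine Finset.filter_congr fun σ _ => ⟨fun h => h.2, fun h => ⟨?_, h⟩⟩
    rw [h]
    exact hs.2
  · intro σ hσ
    have hσ' : ∀ m ∈ σ.partition.parts, m ≤ ℓ := by simpa using hσ
    exact mem_boundedPartitions.2
      ⟨⟨by simpa using σ.partition.parts_sum, fun m hm => σ.partition.parts_pos hm⟩, hσ'⟩

theorem cycleWeight_erase {s : Multiset ℕ} {i : ℕ} (hs : ∀ m ∈ s, 0 < m) (hi : i ∈ s) :
    cycleWeight (s.erase i) = i * s.count i * cycleWeight s := by
  have h0 : 0 < i := hs i hi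
  obtain ⟨t, rfl⟩ := Multiset.exists_cons_of_mem hi
  have ht : 0 < t.prod := Multiset.prod_pos fun m hm => hs m (Multiset.mem_cons_of_mem hm)
  rw [Multiset.erase_cons_head, cycleWeight, cycleWeight]
  have hA : (∏ j ∈ t.toFinset, ((t.count j).factorial : ℝ)) =
      ∏ j ∈ (i ::ₘ t).toFinset, ((t.count j).factorial : ℝ) := by
    refine Finset.prod_subset (fun j hj => ?_) (fun j _ hj => ?_)
    · rw [Multiset.mem_toFinset] at *
      exact Multiset.mem_cons_of_mem hj
    · rw [Multiset.mem_toFinset] at hj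
      rw [Multiset.count_eq_zero_of_notMem hj, Nat.factorial_zero, Nat.cast_one]
  have hmem : i ∈ (i ::ₘ t).toFinset := by simp
  rw [hA, ← Finset.mul_prod_erase _ _ hmem, ← Finset.mul_prod_erase _ _ hmem,
    Multiset.count_cons_self, Nat.factorial_succ]
  have hB : ∏ j ∈ (i ::ₘ t).toFinset.erase i, (((i ::ₘ t).count j).factorial : ℝ) =
      ∏ j ∈ (i ::ₘ t).toFinset.erase i, ((t.count j).factorial : ℝ) :=
    Finset.prod_congr rfl fun j hj => by
      rw [Multiset.count_cons_of_ne (Finset.ne_of_mem_erase hj)]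
  rw [hB, Multiset.prod_cons]
  have hC : (∏ j ∈ (i ::ₘ t).toFinset.erase i, ((t.count j).factorial : ℝ)) ≠ 0 :=
    Finset.prod_ne_zero_iff.2 fun j _ => by positivity
  have ht' : (t.prod : ℝ) ≠ 0 := by exact_mod_cast ht.ne'
  have hi' : (i : ℝ) ≠ 0 := by exact_mod_cast h0.ne'
  have hf : ((t.count i).factorial : ℝ) ≠ 0 := by positivity
  have hc : ((t.count i : ℝ) + 1) ≠ 0 := by positivity
  push_cast
  field_simp

theorem sum_mul_cycleWeight {s : Multiset ℕ} (hs : ∀ m ∈ s, 0 < m) :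
    (s.sum : ℝ) * cycleWeight s = ∑ i ∈ s.toFinset, cycleWeight (s.erase i) := by
  rw [Finset.sum_multiset_count]
  push_cast
  rw [Finset.sum_mul]
  refine Finset.sum_congr rfl fun i hi => ?_
  rw [cycleWeight_erase hs (Multiset.mem_toFinset.1 hi), smul_eq_mul]
  push_cast
  ring

/-- Coefficientwise form of $zF'=(z+\dots+z^\ell)F$ for $F=e^{P}$: writing $n$ as the sum of
$i\cdot\mathrm{count}_i$ turns each weight into a sum over ways to erase one part, and erasing a
part $i$ is undone by adjoining it. -/
theorem boundedCycleCoeff_rec (ℓ n : ℕ) :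
    (n : ℝ) * boundedCycleCoeff ℓ n =
      ∑ i ∈ (Finset.Icc 1 ℓ).filter (· ≤ n), boundedCycleCoeff ℓ (n - i) := by
  simp only [boundedCycleCoeff, Finset.mul_sum]
  rw [Finset.sum_congr rfl (g := fun s => ∑ i ∈ s.toFinset, cycleWeight (s.erase i))
    fun s hs => by
      rw [mem_boundedPartitions] at hs
      rw [← sum_mul_cycleWeight hs.1.2, hs.1.1]]
  rw [Finset.sum_sigma', Finset.sum_sigma']
  refine Finset.sum_bij' (fun a _ => ⟨a.2, a.1.erase a.2⟩) (fun b _ => ⟨b.1 ::ₘ b.2, b.1⟩)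
    ?_ ?_ ?_ ?_ ?_
  · rintro ⟨s, i⟩ h
    simp only [Finset.mem_sigma, mem_boundedPartitions, Multiset.mem_toFinset, Finset.mem_filter,
      Finset.mem_Icc] at h ⊢
    obtain ⟨⟨⟨h1, h2⟩, h3⟩, h4⟩ := h
    have h5 : i + (s.erase i).sum = s.sum := Multiset.sum_erase h4
    refine ⟨⟨⟨h2 i h4, h3 i h4⟩, by omega⟩, ⟨by omega, fun m hm => ?_⟩, fun m hm => ?_⟩
    · exact h2 m (Multiset.mem_of_mem_erase hm)
    · exact h3 m (Multiset.mem_of_mem_erase hm)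
  · rintro ⟨i, s⟩ h
    simp only [Finset.mem_sigma, mem_boundedPartitions, Multiset.mem_toFinset, Finset.mem_filter,
      Finset.mem_Icc, Multiset.mem_cons, Multiset.sum_cons, forall_eq_or_imp] at h ⊢
    obtain ⟨⟨⟨h1, h2⟩, h3⟩, ⟨h4, h5⟩, h6⟩ := h
    exact ⟨⟨⟨by omega, by omega, h5⟩, h2, h6⟩, Or.inl trivial⟩
  · rintro ⟨s, i⟩ h
    simp only [Finset.mem_sigma, Multiset.mem_toFinset] at h
    simp [Multiset.cons_erase h.2]
  · rintro ⟨i, s⟩ h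
    simp
  · rintro ⟨s, i⟩ h
    rfl

theorem boundedCycleCoeff_zero (ℓ : ℕ) : boundedCycleCoeff ℓ 0 = 1 := by
  have : boundedPartitions ℓ 0 = {0} := by
    ext s
    rw [mem_boundedPartitions, Finset.mem_singleton]
    constructor
    · rintro ⟨⟨h1, h2⟩, -⟩
      rw [Multiset.sum_eq_zero_iff] at h1
      refine Multiset.eq_zero_of_forall_notMem fun m hm => ?_
      have := h1 m hm
      have := h2 m hm
      omega
    · rintro rfl
      simp
  rw [boundedCycleCoeff, this, Finset.sum_singleton, cycleWeight]
  simp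

/-! ### Cauchy's integral for the coefficients. -/

/-- The polynomial `z + z ^ 2 / 2 + ⋯ + z ^ ℓ / ℓ`, over a field. -/
noncomputable def cyclePoly {K : Type*} [Field K] (ℓ : ℕ) (z : K) : K :=
  ∑ j ∈ Finset.Icc 1 ℓ, z ^ j / (j : K)

theorem hasDerivAt_cyclePoly (ℓ : ℕ) (z : ℂ) :
    HasDerivAt (cyclePoly ℓ) (∑ j ∈ Finset.Icc 1 ℓ, z ^ (j - 1)) z := by
  unfold cyclePoly
  refine HasDerivAt.fun_sum fun j hj => ?_
  have hj' : (j : ℂ) ≠ 0 := by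
    have := (Finset.mem_Icc.1 hj).1
    exact_mod_cast (by omega : j ≠ 0)
  have h := (hasDerivAt_pow j z).div_const (j : ℂ)
  rwa [mul_div_assoc, mul_div_cancel₀ _ hj'] at h

theorem differentiable_exp_cyclePoly (ℓ : ℕ) :
    Differentiable ℂ (fun z : ℂ => Complex.exp (cyclePoly ℓ z)) := fun z =>
  (hasDerivAt_cyclePoly ℓ z).differentiableAt.cexp

theorem circleIntegrable_exp_cyclePoly_mul {ℓ : ℕ} {r : ℝ} (hr : 0 < r) (a b : ℕ) :
    CircleIntegrable (fun z : ℂ => Complex.exp (cyclePoly ℓ z) * (z ^ a * (z ^ b)⁻¹)) 0 r := by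
  refine ContinuousOn.circleIntegrable hr.le ?_
  refine (differentiable_exp_cyclePoly ℓ).continuous.continuousOn.mul
    ((continuous_pow a).continuousOn.mul ((continuous_pow b).continuousOn.inv₀ fun z hz => ?_))
  have : z ≠ 0 := by
    rintro rfl
    simp at hz
    exact hr.ne hz
  exact pow_ne_zero _ this

theorem circleIntegral_exp_cyclePoly_mul_pow (ℓ : ℕ) {r : ℝ} (hr : 0 < r) {a b : ℕ} (h : b ≤ a) :
    (∮ z in C(0, r), Complex.exp (cyclePoly ℓ z) * (z ^ a * (z ^ b)⁻¹)) = 0 := by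
  have h1 : (∮ z in C(0, r), Complex.exp (cyclePoly ℓ z) * (z ^ a * (z ^ b)⁻¹)) =
      ∮ z in C(0, r), Complex.exp (cyclePoly ℓ z) * z ^ (a - b) := by
    refine circleIntegral.integral_congr hr.le fun z hz => ?_
    have : z ≠ 0 := by
      rintro rfl
      simp at hz
      exact hr.ne hz
    rw [pow_sub₀ z this h]
  rw [h1]
  have hd : Differentiable ℂ (fun z : ℂ => Complex.exp (cyclePoly ℓ z) * z ^ (a - b)) :=
    (differentiable_exp_cyclePoly ℓ).mul (differentiable_id.pow _)
  exact Complex.circleIntegral_eq_zero_of_differentiable_on_off_countable hr.le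
    Set.countable_empty hd.continuous.continuousOn fun z _ => hd z

/-- The derivative of $e^{P(z)}z^{-n}$ integrates to zero over the closed circle. -/
theorem circleIntegral_exp_cyclePoly_rec (ℓ : ℕ) {r : ℝ} (hr : 0 < r) (n : ℕ) :
    (n : ℂ) * (∮ z in C(0, r), Complex.exp (cyclePoly ℓ z) * (z ^ (n + 1))⁻¹) =
      ∑ i ∈ (Finset.Icc 1 ℓ).filter (· ≤ n),
        ∮ z in C(0, r), Complex.exp (cyclePoly ℓ z) * (z ^ (n - i + 1))⁻¹ := by
  have hne : ∀ z ∈ Metric.sphere (0 : ℂ) r, z ≠ 0 := by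
    rintro z hz rfl
    simp at hz
    exact hr.ne hz
  have hder : (∮ z in C(0, r), (∑ i ∈ Finset.Icc 1 ℓ,
      Complex.exp (cyclePoly ℓ z) * (z ^ (i - 1) * (z ^ n)⁻¹)) -
        n * (Complex.exp (cyclePoly ℓ z) * (z ^ (n + 1))⁻¹)) = 0 := by
    refine circleIntegral.integral_eq_zero_of_hasDerivWithinAt
      (f := fun z => Complex.exp (cyclePoly ℓ z) * (z ^ n)⁻¹) hr.le fun z hz => ?_
    have hz0 := hne z hz
    have h := ((hasDerivAt_cyclePoly ℓ z).cexp.mul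
      ((hasDerivAt_pow n z).inv (pow_ne_zero n hz0))).hasDerivWithinAt (s := Metric.sphere 0 r)
    refine h.congr_deriv ?_
    rw [← Finset.mul_sum, ← Finset.sum_mul]
    simp only [Pi.inv_apply]
    rcases Nat.eq_zero_or_pos n with rfl | hn
    · simp
    · obtain ⟨m, rfl⟩ : ∃ m, n = m + 1 := ⟨n - 1, by omega⟩
      rw [Nat.add_sub_cancel]
      field_simp
      ring
  rw [circleIntegral.integral_sub, circleIntegral.integral_const_mul] at hder
  rotate_left
  · refine CircleIntegrable.fun_sum _ fun i _ => circleIntegrable_exp_cyclePoly_mul hr _ _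
  · have := circleIntegrable_exp_cyclePoly_mul (ℓ := ℓ) hr 0 (n + 1)
    simp only [pow_zero, one_mul] at this
    exact this.const_mul (n : ℂ)
  rw [← sub_eq_zero.1 hder, circleIntegral.integral_fun_sum
    fun i _ => circleIntegrable_exp_cyclePoly_mul hr _ _, Finset.sum_filter]
  refine Finset.sum_congr rfl fun i hi => ?_
  have hi' := (Finset.mem_Icc.1 hi).1
  split_ifs with hin
  · refine circleIntegral.integral_congr hr.le fun z hz => ?_
    have hz0 := hne z hz
    congr 1
    obtain ⟨k, rfl⟩ : ∃ k, n = k + i := ⟨n - i, by omega⟩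
    obtain ⟨j, rfl⟩ : ∃ j, i = j + 1 := ⟨i - 1, by omega⟩
    rw [Nat.add_sub_cancel, Nat.add_sub_cancel]
    field_simp
    ring
  -- For $i>n$ the power $z^{i-1-n}$ has no pole, so these terms drop out.
  · exact circleIntegral_exp_cyclePoly_mul_pow ℓ hr (by omega)

theorem circleIntegral_exp_cyclePoly (ℓ : ℕ) {r : ℝ} (hr : 0 < r) (n : ℕ) :
    (∮ z in C(0, r), Complex.exp (cyclePoly ℓ z) * (z ^ (n + 1))⁻¹) =
      2 * Real.pi * Complex.I * boundedCycleCoeff ℓ n := by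
  induction n using Nat.strong_induction_on with
  | _ n ih =>
    rcases Nat.eq_zero_or_pos n with rfl | hn
    · have h := Complex.circleIntegral_sub_center_inv_smul_of_differentiable_on_off_countable
        (c := 0) hr Set.countable_empty
        (differentiable_exp_cyclePoly ℓ).continuous.continuousOn
        fun z _ => differentiable_exp_cyclePoly ℓ z
      have h0 : cyclePoly ℓ (0 : ℂ) = 0 := Finset.sum_eq_zero fun j hj => by
        have := (Finset.mem_Icc.1 hj).1
        rw [zero_pow (by omega), zero_div]
      simp only [sub_zero, smul_eq_mul, h0, Complex.exp_zero, mul_one] at h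
      rw [boundedCycleCoeff_zero, Complex.ofReal_one, mul_one, ← h]
      simp [mul_comm]
    · have hn' : (n : ℂ) ≠ 0 := by exact_mod_cast hn.ne'
      apply mul_left_cancel₀ hn'
      rw [circleIntegral_exp_cyclePoly_rec ℓ hr]
      have h := congrArg (fun x : ℝ => (x : ℂ)) (boundedCycleCoeff_rec ℓ n)
      push_cast at h
      rw [mul_left_comm, h, Finset.mul_sum]
      refine Finset.sum_congr rfl fun i hi => ih _ ?_
      have := (Finset.mem_Icc.1 (Finset.mem_filter.1 hi).1).1
      omega

/-! ### The saddle point integral and its Gaussian limit. -/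

/-- The exponent of the saddle point integrand on the circle of radius `r`. -/
noncomputable def saddleExponent (ℓ : ℕ) (r θ : ℝ) : ℂ :=
  ∑ j ∈ Finset.Icc 1 ℓ, ((r ^ j / j : ℝ) : ℂ) *
    (Complex.exp ((j * θ : ℝ) * Complex.I) - 1 - (j * θ : ℝ) * Complex.I)

/-- The second derivative at the saddle point. -/
noncomputable def saddleVariance (ℓ : ℕ) (r : ℝ) : ℝ := ∑ j ∈ Finset.Icc 1 ℓ, (j : ℝ) * r ^ j

theorem continuous_saddleExponent (ℓ : ℕ) (r : ℝ) : Continuous (saddleExponent ℓ r) := by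
  unfold saddleExponent
  fun_prop

/-- The saddle equation makes the terms linear in $\theta$ add up to $in\theta$, which is what
$z^{-n}$ cancels under the integral. -/
theorem cyclePoly_circleMap (ℓ : ℕ) (r θ : ℝ) (n : ℕ)
    (hn : ∑ j ∈ Finset.Icc 1 ℓ, r ^ j = n) :
    cyclePoly ℓ (circleMap 0 r θ) =
      saddleExponent ℓ r θ + (cyclePoly ℓ r : ℝ) + n * (θ * Complex.I) := by
  have hn' : ((∑ j ∈ Finset.Icc 1 ℓ, r ^ j : ℝ) : ℂ) = n := by rw [hn]; simp
  rw [← hn']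
  simp only [cyclePoly, saddleExponent, Complex.ofReal_sum, Finset.sum_mul]
  rw [← Finset.sum_add_distrib, ← Finset.sum_add_distrib]
  refine Finset.sum_congr rfl fun j hj => ?_
  have hj' : (j : ℂ) ≠ 0 := by
    have := (Finset.mem_Icc.1 hj).1
    exact_mod_cast (by omega : j ≠ 0)
  rw [circleMap_zero, mul_pow, ← Complex.exp_nat_mul, ← mul_assoc]
  push_cast
  field_simp
  ring

theorem integral_exp_saddleExponent (ℓ : ℕ) {r : ℝ} (hr : 0 < r) (n : ℕ)
    (hn : ∑ j ∈ Finset.Icc 1 ℓ, r ^ j = n) :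
    ∫ θ in -Real.pi..Real.pi, Complex.exp (saddleExponent ℓ r θ) =
      ((2 * Real.pi * (boundedCycleCoeff ℓ n * r ^ n * Real.exp (-cyclePoly ℓ r)) : ℝ) : ℂ) := by
  have h := circleIntegral_exp_cyclePoly ℓ hr n
  have hpt : ∀ θ : ℝ, deriv (circleMap 0 r) θ •
      (Complex.exp (cyclePoly ℓ (circleMap 0 r θ)) * (circleMap 0 r θ ^ (n + 1))⁻¹) =
      (Complex.I * Complex.exp (cyclePoly ℓ r : ℝ) * ((r : ℂ) ^ n)⁻¹) *
        Complex.exp (saddleExponent ℓ r θ) := by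
    intro θ
    have h0 : circleMap 0 r θ ≠ 0 := circleMap_ne_center hr.ne'
    have h1 : circleMap 0 r θ ^ n = (r : ℂ) ^ n * Complex.exp (n * (θ * Complex.I)) := by
      rw [circleMap_zero, mul_pow, ← Complex.exp_nat_mul]
    rw [deriv_circleMap, smul_eq_mul, pow_succ, cyclePoly_circleMap ℓ r θ n hn, Complex.exp_add,
      Complex.exp_add]
    rw [h1]
    have h2 := Complex.exp_ne_zero (n * (θ * Complex.I))
    have h3 : (r : ℂ) ≠ 0 := by exact_mod_cast hr.ne'
    field_simp
  rw [circleIntegral] at h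
  simp only [hpt] at h
  rw [intervalIntegral.integral_const_mul] at h
  -- The exponent is not periodic because of its linear term; its exponential is, being a constant
  -- multiple of the Cauchy integrand.
  have hper : Function.Periodic (fun θ : ℝ => Complex.exp (saddleExponent ℓ r θ))
      (2 * Real.pi) := by
    intro θ
    have hc : (Complex.I * Complex.exp (cyclePoly ℓ r : ℝ) * ((r : ℂ) ^ n)⁻¹) ≠ 0 := by
      have h3 : (r : ℂ) ≠ 0 := by exact_mod_cast hr.ne'
      exact mul_ne_zero (mul_ne_zero Complex.I_ne_zero (Complex.exp_ne_zero _))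
        (inv_ne_zero (pow_ne_zero _ h3))
    apply mul_left_cancel₀ hc
    rw [← hpt, ← hpt, deriv_circleMap, deriv_circleMap, periodic_circleMap 0 r θ]
  have hshift := hper.intervalIntegral_add_eq (-Real.pi) 0
  rw [show -Real.pi + 2 * Real.pi = Real.pi by ring, zero_add] at hshift
  rw [hshift]
  have h3 : (r : ℂ) ≠ 0 := by exact_mod_cast hr.ne'
  have h4 := Complex.exp_ne_zero (cyclePoly ℓ r : ℝ)
  have h5 := Complex.I_ne_zero
  push_cast [Complex.exp_neg]
  field_simp at h ⊢
  linear_combination h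

theorem re_saddleExponent (ℓ : ℕ) (r θ : ℝ) :
    (saddleExponent ℓ r θ).re =
      ∑ j ∈ Finset.Icc 1 ℓ, r ^ j / j * (Real.cos (j * θ) - 1) := by
  simp only [saddleExponent, Complex.re_sum, Complex.re_ofReal_mul]
  refine Finset.sum_congr rfl fun j _ => ?_
  rw [Complex.sub_re, Complex.sub_re, Complex.exp_ofReal_mul_I_re, Complex.re_ofReal_mul]
  simp

/-- In this range every $|j\theta|$ is at most $\pi$, so $1-\cos x\ge 2x^2/\pi^2$ applies to each
term. After rescaling by the variance the bound no longer depends on $r$, as dominated convergence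
requires. -/
theorem re_saddleExponent_le_central {ℓ : ℕ} {r θ : ℝ} (hr : 0 < r) (hθ : ℓ * |θ| ≤ Real.pi) :
    (saddleExponent ℓ r θ).re ≤ -(2 / Real.pi ^ 2) * (saddleVariance ℓ r * θ ^ 2) := by
  rw [re_saddleExponent, saddleVariance, Finset.sum_mul, Finset.mul_sum]
  refine Finset.sum_le_sum fun j hj => ?_
  have hj' := Finset.mem_Icc.1 hj
  have hj0 : (0 : ℝ) < j := by exact_mod_cast hj'.1
  have hjl : (j : ℝ) ≤ ℓ := by exact_mod_cast hj'.2
  have h1 : |(j : ℝ) * θ| ≤ Real.pi := by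
    rw [abs_mul, abs_of_pos hj0]
    exact (mul_le_mul_of_nonneg_right hjl (abs_nonneg _)).trans hθ
  have h2 := Real.cos_le_one_sub_mul_cos_sq h1
  calc r ^ j / j * (Real.cos (j * θ) - 1) ≤ r ^ j / j * (-(2 / Real.pi ^ 2 * (j * θ) ^ 2)) :=
        mul_le_mul_of_nonneg_left (by linarith) (by positivity)
    _ = -(2 / Real.pi ^ 2) * (j * r ^ j * θ ^ 2) := by
        field_simp

/-- All terms are nonpositive, and the one with $j=1$ alone is already enough away from the centre.
-/
theorem re_saddleExponent_le_tail {ℓ : ℕ} (hℓ : 1 ≤ ℓ) {r θ : ℝ} (hr : 0 < r)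
    (hθ : |θ| ≤ Real.pi) :
    (saddleExponent ℓ r θ).re ≤ -(2 / Real.pi ^ 2) * (r * θ ^ 2) := by
  rw [re_saddleExponent]
  have h1 : ∑ j ∈ Finset.Icc 1 ℓ, r ^ j / j * (Real.cos (j * θ) - 1) ≤
      r ^ 1 / (1 : ℕ) * (Real.cos ((1 : ℕ) * θ) - 1) := by
    rw [← Finset.add_sum_erase _ _ (Finset.mem_Icc.2 ⟨le_rfl, hℓ⟩)]
    refine add_le_of_nonpos_right (Finset.sum_nonpos fun j _ => ?_)
    exact mul_nonpos_of_nonneg_of_nonpos (by positivity) (by linarith [Real.cos_le_one (j * θ)])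
  have h2 := Real.cos_le_one_sub_mul_cos_sq hθ
  refine h1.trans ?_
  simp only [pow_one, Nat.cast_one, div_one, one_mul]
  nlinarith

theorem le_saddleVariance {ℓ : ℕ} (hℓ : 1 ≤ ℓ) {r : ℝ} (hr : 0 < r) : r ≤ saddleVariance ℓ r := by
  have := Finset.single_le_sum (f := fun j : ℕ => (j : ℝ) * r ^ j) (fun j _ => by positivity)
    (Finset.mem_Icc.2 ⟨le_rfl, hℓ⟩)
  rwa [Nat.cast_one, one_mul, pow_one] at this

theorem saddleVariance_le {ℓ : ℕ} {r : ℝ} (hr : 1 ≤ r) :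
    saddleVariance ℓ r ≤ (ℓ : ℝ) ^ 2 * r ^ ℓ := by
  have : saddleVariance ℓ r ≤ ∑ j ∈ Finset.Icc 1 ℓ, (ℓ : ℝ) * r ^ ℓ := by
    refine Finset.sum_le_sum fun j hj => ?_
    have hj' := Finset.mem_Icc.1 hj
    have hjl : (j : ℝ) ≤ ℓ := by exact_mod_cast hj'.2
    exact mul_le_mul hjl (pow_le_pow_right₀ hr hj'.2) (by positivity) (by positivity)
  refine this.trans (le_of_eq ?_)
  simp
  ring

theorem tendsto_saddleVariance {ℓ : ℕ} (hℓ : 1 ≤ ℓ) :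
    Tendsto (saddleVariance ℓ) atTop atTop :=
  tendsto_atTop_mono' _ ((eventually_gt_atTop 0).mono fun _ hr => le_saddleVariance hℓ hr)
    tendsto_id

/-- Cubic Taylor remainder of $e^{ij\theta}$, term by term; one surplus factor $j$ is bounded by
$\ell$ so that the sum is again the variance. -/
theorem norm_saddleExponent_add_le {ℓ : ℕ} {r θ : ℝ} (hr : 0 < r) (hθ : ℓ * |θ| ≤ 1) :
    ‖saddleExponent ℓ r θ + ((saddleVariance ℓ r * θ ^ 2 / 2 : ℝ) : ℂ)‖ ≤
      ℓ * (saddleVariance ℓ r * |θ| ^ 3) := by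
  have h1 : saddleExponent ℓ r θ + ((saddleVariance ℓ r * θ ^ 2 / 2 : ℝ) : ℂ) =
      ∑ j ∈ Finset.Icc 1 ℓ, ((r ^ j / j : ℝ) : ℂ) *
        (Complex.exp ((j * θ : ℝ) * Complex.I) -
          ∑ m ∈ Finset.range 3, ((j * θ : ℝ) * Complex.I) ^ m / (m.factorial : ℂ)) := by
    rw [saddleExponent, saddleVariance, Finset.sum_mul, Finset.sum_div, Complex.ofReal_sum,
      ← Finset.sum_add_distrib]
    refine Finset.sum_congr rfl fun j hj => ?_
    have hj' : (j : ℂ) ≠ 0 := by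
      have := (Finset.mem_Icc.1 hj).1
      exact_mod_cast (by omega : j ≠ 0)
    simp only [Finset.sum_range_succ, Finset.sum_range_zero, Nat.factorial]
    push_cast
    rw [mul_pow _ Complex.I 2, Complex.I_sq]
    field_simp
    ring
  rw [h1, saddleVariance, Finset.sum_mul, Finset.mul_sum]
  refine (norm_sum_le _ _).trans (Finset.sum_le_sum fun j hj => ?_)
  have hj' := Finset.mem_Icc.1 hj
  have hj0 : (0 : ℝ) < j := by exact_mod_cast hj'.1
  have hjl : (j : ℝ) ≤ ℓ := by exact_mod_cast hj'.2
  have hnorm : ‖((j * θ : ℝ) : ℂ) * Complex.I‖ = j * |θ| := by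
    rw [norm_mul, Complex.norm_I, mul_one, Complex.norm_real, Real.norm_eq_abs, abs_mul,
      abs_of_pos hj0]
  have h2 := Complex.exp_bound (x := ((j * θ : ℝ) : ℂ) * Complex.I) (by
    rw [hnorm]
    exact (mul_le_mul_of_nonneg_right hjl (abs_nonneg _)).trans hθ) (n := 3) (by norm_num)
  rw [hnorm] at h2
  rw [norm_mul, Complex.norm_real, Real.norm_eq_abs, abs_of_pos (by positivity)]
  have h3 : ((j : ℝ) * |θ|) ^ 3 * ((Nat.succ 3 : ℕ) * (((3 : ℕ).factorial * (3 : ℕ) : ℝ))⁻¹) ≤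
      ((j : ℝ) * |θ|) ^ 3 := by
    refine mul_le_of_le_one_right (by positivity) ?_
    norm_num [Nat.factorial]
  calc r ^ j / j * _ ≤ r ^ j / j * ((j : ℝ) * |θ|) ^ 3 :=
        mul_le_mul_of_nonneg_left (h2.trans h3) (by positivity)
    _ = j * (j * r ^ j * |θ| ^ 3) := by
        field_simp
    _ ≤ ℓ * (j * r ^ j * |θ| ^ 3) := mul_le_mul_of_nonneg_right hjl (by positivity)

theorem tendsto_saddleExponent_scaled {ℓ : ℕ} (hℓ : 1 ≤ ℓ) (s : ℝ) :
    Tendsto (fun r : ℝ => saddleExponent ℓ r (s / √(saddleVariance ℓ r))) atTop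
      (nhds ((-(1 / 2) * s ^ 2 : ℝ) : ℂ)) := by
  have hB : Tendsto (fun r => √(saddleVariance ℓ r)) atTop atTop :=
    Real.tendsto_sqrt_atTop.comp (tendsto_saddleVariance hℓ)
  rw [tendsto_iff_norm_sub_tendsto_zero]
  have hlim : Tendsto (fun r => ℓ * |s| ^ 3 / √(saddleVariance ℓ r)) atTop (nhds 0) :=
    hB.const_div_atTop _
  refine squeeze_zero' (Eventually.of_forall fun _ => norm_nonneg _) ?_ hlim
  filter_upwards [eventually_gt_atTop 0, hB.eventually_ge_atTop (ℓ * |s|), hB.eventually_gt_atTop 0]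
    with r hr h1 h2
  have hV : 0 < saddleVariance ℓ r := hr.trans_le (le_saddleVariance hℓ hr)
  have hsq : √(saddleVariance ℓ r) ^ 2 = saddleVariance ℓ r := Real.sq_sqrt hV.le
  have habs : |s / √(saddleVariance ℓ r)| = |s| / √(saddleVariance ℓ r) := by
    rw [abs_div, abs_of_pos h2]
  have h3 := norm_saddleExponent_add_le (ℓ := ℓ) (θ := s / √(saddleVariance ℓ r)) hr (by
    rw [habs, mul_div_assoc', div_le_one h2]
    exact h1)
  rw [habs] at h3
  have h4 : saddleVariance ℓ r * (s / √(saddleVariance ℓ r)) ^ 2 / 2 = 1 / 2 * s ^ 2 := by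
    rw [div_pow, hsq]
    field_simp
  have h5 : ℓ * (saddleVariance ℓ r * (|s| / √(saddleVariance ℓ r)) ^ 3) =
      ℓ * |s| ^ 3 / √(saddleVariance ℓ r) := by
    nth_rewrite 1 [← hsq]
    field_simp
  rw [h4, h5] at h3
  rw [show ((-(1 / 2) * s ^ 2 : ℝ) : ℂ) = -((1 / 2 * s ^ 2 : ℝ) : ℂ) by push_cast; ring,
    sub_neg_eq_add]
  exact h3

theorem tendsto_integral_central {ℓ : ℕ} (hℓ : 1 ≤ ℓ) :
    Tendsto (fun r : ℝ => (√(saddleVariance ℓ r) : ℂ) *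
      ∫ θ in -(Real.pi / ℓ)..Real.pi / ℓ, Complex.exp (saddleExponent ℓ r θ)) atTop
      (nhds ((√(2 * Real.pi) : ℝ) : ℂ)) := by
  have hl : (0 : ℝ) < ℓ := by exact_mod_cast hℓ
  have hpi := Real.pi_pos
  have hB : Tendsto (fun r => √(saddleVariance ℓ r)) atTop atTop :=
    Real.tendsto_sqrt_atTop.comp (tendsto_saddleVariance hℓ)
  set A : ℝ → Set ℝ := fun r => Set.Ioc (-(Real.pi / ℓ) * √(saddleVariance ℓ r))
    (Real.pi / ℓ * √(saddleVariance ℓ r)) with hA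
  set F : ℝ → ℝ → ℂ := fun r => (A r).indicator
    (fun s => Complex.exp (saddleExponent ℓ r (s / √(saddleVariance ℓ r)))) with hF
  have hgauss : ∫ s : ℝ, Complex.exp ((-(1 / 2) * s ^ 2 : ℝ) : ℂ) =
      ((√(2 * Real.pi) : ℝ) : ℂ) := by
    have h := integral_gaussian (1 / 2)
    rw [show Real.pi / (1 / 2) = 2 * Real.pi by ring] at h
    rw [← h, ← integral_complex_ofReal]
    simp only [Complex.ofReal_exp]
  have hmain : Tendsto (fun r => ∫ s, F r s) atTop
      (nhds (∫ s : ℝ, Complex.exp ((-(1 / 2) * s ^ 2 : ℝ) : ℂ))) := by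
    refine MeasureTheory.tendsto_integral_filter_of_dominated_convergence
      (fun s => Real.exp (-(2 / Real.pi ^ 2) * s ^ 2)) ?_ ?_
      (integrable_exp_neg_mul_sq (by positivity)) ?_
    · refine Eventually.of_forall fun r => ?_
      refine (Continuous.measurable ?_).aestronglyMeasurable.indicator measurableSet_Ioc
      exact Complex.continuous_exp.comp
        ((continuous_saddleExponent ℓ r).comp (continuous_id.div_const _))
    · filter_upwards [eventually_gt_atTop 0] with r hr
      refine Eventually.of_forall fun s => ?_
      have hV : 0 < saddleVariance ℓ r := hr.trans_le (le_saddleVariance hℓ hr)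
      have hsq : √(saddleVariance ℓ r) ^ 2 = saddleVariance ℓ r := Real.sq_sqrt hV.le
      have h2 : 0 < √(saddleVariance ℓ r) := Real.sqrt_pos.2 hV
      by_cases hs : s ∈ A r
      · rw [hF]
        simp only [Set.indicator_of_mem hs, Complex.norm_exp]
        rw [Real.exp_le_exp]
        have h3 := re_saddleExponent_le_central (ℓ := ℓ) (θ := s / √(saddleVariance ℓ r)) hr (by
          rw [abs_div, abs_of_pos h2, mul_div_assoc', div_le_iff₀ h2, ← le_div_iff₀' hl, abs_le]
          constructor
          · have := hs.1
            ring_nf at this ⊢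
            exact this.le
          · have := hs.2
            ring_nf at this ⊢
            exact this)
        rw [div_pow, hsq, mul_div_cancel₀ _ hV.ne'] at h3
        exact h3
      · rw [hF]
        simp only [Set.indicator_of_notMem hs, norm_zero]
        positivity
    · refine Eventually.of_forall fun s => ?_
      have h1 := (Complex.continuous_exp.tendsto _).comp (tendsto_saddleExponent_scaled hℓ s)
      refine h1.congr' ?_
      filter_upwards [hB.eventually_gt_atTop (|s| / (Real.pi / ℓ))] with r hr
      have hs : s ∈ A r := by
        rw [div_lt_iff₀ (by positivity), abs_lt] at hr
        constructor
        · linarith [hr.1]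
        · linarith [hr.2]
      rw [hF]
      simp only [Set.indicator_of_mem hs, Function.comp_apply]
  rw [hgauss] at hmain
  refine hmain.congr' ?_
  filter_upwards [eventually_gt_atTop 0] with r hr
  have hV : 0 < saddleVariance ℓ r := hr.trans_le (le_saddleVariance hℓ hr)
  have h2 : 0 < √(saddleVariance ℓ r) := Real.sqrt_pos.2 hV
  rw [hF, MeasureTheory.integral_indicator measurableSet_Ioc,
    ← intervalIntegral.integral_of_le (by
      have : 0 ≤ Real.pi / ℓ * √(saddleVariance ℓ r) := by positivity
      linarith),
    intervalIntegral.integral_comp_div (fun θ => Complex.exp (saddleExponent ℓ r θ)) h2.ne',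
    mul_div_cancel_right₀ _ h2.ne', mul_div_cancel_right₀ _ h2.ne', Complex.real_smul]

/-- The integrand is at most $e^{-2r/\ell^2}$ here, while the variance grows only polynomially in
$r$. -/
theorem tendsto_integral_tail {ℓ : ℕ} (hℓ : 1 ≤ ℓ) {a b : ℝ}
    (hab : ∀ θ ∈ Set.uIoc a b, |θ| ≤ Real.pi ∧ Real.pi / ℓ ≤ |θ|) :
    Tendsto (fun r : ℝ => (√(saddleVariance ℓ r) : ℂ) *
      ∫ θ in a..b, Complex.exp (saddleExponent ℓ r θ)) atTop (nhds 0) := by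
  have hl : (0 : ℝ) < ℓ := by exact_mod_cast hℓ
  have hpi := Real.pi_pos
  have hlim := ((tendsto_rpow_mul_exp_neg_mul_atTop_nhds_zero (ℓ : ℝ) (2 / (ℓ : ℝ) ^ 2)
    (by positivity)).const_mul ((ℓ : ℝ) ^ 2)).mul_const |b - a|
  rw [mul_zero, zero_mul] at hlim
  refine squeeze_zero_norm' ?_ hlim
  filter_upwards [eventually_ge_atTop 1] with r hr
  have hr0 : 0 < r := by linarith
  have hV : 1 ≤ saddleVariance ℓ r := hr.trans (le_saddleVariance hℓ hr0)
  have h1 : ‖∫ θ in a..b, Complex.exp (saddleExponent ℓ r θ)‖ ≤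
      Real.exp (-(2 / (ℓ : ℝ) ^ 2) * r) * |b - a| := by
    refine intervalIntegral.norm_integral_le_of_norm_le_const fun θ hθ => ?_
    obtain ⟨h2, h3⟩ := hab θ hθ
    rw [Complex.norm_exp, Real.exp_le_exp]
    refine (re_saddleExponent_le_tail hℓ hr0 h2).trans ?_
    have h4 : (Real.pi / ℓ) ^ 2 ≤ θ ^ 2 := by
      rw [← sq_abs θ]
      exact pow_le_pow_left₀ (by positivity) h3 2
    have h5 : 2 / Real.pi ^ 2 * (r * (Real.pi / ℓ) ^ 2) ≤ 2 / Real.pi ^ 2 * (r * θ ^ 2) := by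
      gcongr
    have h6 : 2 / Real.pi ^ 2 * (r * (Real.pi / ℓ) ^ 2) = 2 / (ℓ : ℝ) ^ 2 * r := by
      field_simp
    linarith
  -- As the variance is at least 1, its root is at most the variance itself.
  have h7 : √(saddleVariance ℓ r) ≤ (ℓ : ℝ) ^ 2 * r ^ ℓ :=
    (Real.sqrt_le_left (by positivity) |>.2 (by nlinarith)).trans (saddleVariance_le hr)
  rw [norm_mul, Complex.norm_real, Real.norm_eq_abs, abs_of_nonneg (Real.sqrt_nonneg _),
    Real.rpow_natCast]
  calc _ ≤ ((ℓ : ℝ) ^ 2 * r ^ ℓ) * (Real.exp (-(2 / (ℓ : ℝ) ^ 2) * r) * |b - a|) := by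
        gcongr
    _ = _ := by ring

theorem tendsto_integral_exp_saddleExponent {ℓ : ℕ} (hℓ : 1 ≤ ℓ) :
    Tendsto (fun r : ℝ => (√(saddleVariance ℓ r) : ℂ) *
      ∫ θ in -Real.pi..Real.pi, Complex.exp (saddleExponent ℓ r θ)) atTop
      (nhds ((√(2 * Real.pi) : ℝ) : ℂ)) := by
  have hl : (1 : ℝ) ≤ ℓ := by exact_mod_cast hℓ
  have hpi := Real.pi_pos
  have hle : Real.pi / ℓ ≤ Real.pi := div_le_self hpi.le hl
  have hpl : 0 < Real.pi / ℓ := by positivity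
  have h1 := tendsto_integral_tail hℓ (a := -Real.pi) (b := -(Real.pi / ℓ)) (fun θ hθ => by
    rw [Set.uIoc_of_le (by linarith)] at hθ
    rw [abs_of_nonpos (by linarith [hθ.2])]
    constructor <;> linarith [hθ.1, hθ.2])
  have h2 := tendsto_integral_tail hℓ (a := Real.pi / ℓ) (b := Real.pi) (fun θ hθ => by
    rw [Set.uIoc_of_le (by linarith)] at hθ
    rw [abs_of_nonneg (by linarith [hθ.1])]
    constructor <;> linarith [hθ.1, hθ.2])
  have h3 := (h1.add (tendsto_integral_central hℓ)).add h2
  rw [zero_add, add_zero] at h3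
  refine h3.congr fun r => ?_
  have hint : ∀ a b, IntervalIntegrable (fun θ => Complex.exp (saddleExponent ℓ r θ))
      MeasureTheory.volume a b := fun a b =>
    (Complex.continuous_exp.comp (continuous_saddleExponent ℓ r)).intervalIntegrable a b
  rw [← mul_add, ← mul_add, intervalIntegral.integral_add_adjacent_intervals (hint _ _) (hint _ _),
    intervalIntegral.integral_add_adjacent_intervals (hint _ _) (hint _ _)]

theorem tendsto_boundedCycleCoeff_saddle {ℓ : ℕ} (hℓ : 1 ≤ ℓ) {ρ : ℕ → ℝ}
    (hρ : Tendsto ρ atTop atTop)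
    (hsaddle : ∀ᶠ n : ℕ in atTop, ∑ j ∈ Finset.Icc 1 ℓ, ρ n ^ j = n) :
    Tendsto (fun n : ℕ => √(2 * Real.pi * saddleVariance ℓ (ρ n)) *
      (boundedCycleCoeff ℓ n * ρ n ^ n * Real.exp (-cyclePoly ℓ (ρ n)))) atTop (nhds 1) := by
  have h := (tendsto_integral_exp_saddleExponent hℓ).comp hρ
  have hpi := Real.pi_pos
  have hs : √(2 * Real.pi) ≠ 0 := by positivity
  have hss : √(2 * Real.pi) * √(2 * Real.pi) = 2 * Real.pi := Real.mul_self_sqrt (by positivity)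
  have h2 := ((Complex.continuous_re.tendsto _).comp h).div_const √(2 * Real.pi)
  rw [Complex.ofReal_re, div_self hs] at h2
  refine h2.congr' ?_
  filter_upwards [hsaddle, hρ.eventually_gt_atTop 0] with n hn h0
  simp only [Function.comp_apply]
  rw [integral_exp_saddleExponent ℓ h0 n hn, ← Complex.ofReal_mul, Complex.ofReal_re,
    Real.sqrt_mul (show 0 ≤ 2 * Real.pi by positivity) (saddleVariance ℓ (ρ n)), div_eq_iff hs]
  linear_combination (√(saddleVariance ℓ (ρ n)) *
    (boundedCycleCoeff ℓ n * ρ n ^ n * Real.exp (-cyclePoly ℓ (ρ n)))) * (-hss)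

/-! ### Lagrange inversion identities. -/

/-- The coefficient of `w ^ j` in `(1 - w) ^ (-a)`. -/
noncomputable def risingCoeff (a : ℝ) (j : ℕ) : ℝ :=
  (∏ i ∈ Finset.range j, (a + i)) / (j.factorial : ℝ)

/-- The coefficient of `u ^ k` in `-log (1 - w)`, where `u = w * (1 - w) ^ x`. -/
noncomputable def lagrangeCoeff (x : ℝ) (k : ℕ) : ℝ :=
  (∏ i ∈ Finset.Ico 1 k, ((k : ℝ) * x + i)) / (k.factorial : ℝ)

theorem risingCoeff_zero (a : ℝ) : risingCoeff a 0 = 1 := by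
  simp [risingCoeff]

theorem prod_range_succ_shift (a : ℝ) (j : ℕ) :
    ∏ i ∈ Finset.range (j + 1), (a + i) = a * ∏ i ∈ Finset.range j, (a + 1 + i) := by
  rw [Finset.prod_range_succ', mul_comm]
  simp only [Nat.cast_zero, add_zero]
  congr 1
  refine Finset.prod_congr rfl fun i _ => ?_
  push_cast
  ring

theorem risingCoeff_succ_shift (a : ℝ) (j : ℕ) :
    (j + 1 : ℝ) * risingCoeff a (j + 1) = a * risingCoeff (a + 1) j := by
  rw [risingCoeff, risingCoeff, prod_range_succ_shift, Nat.factorial_succ]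
  have : (j.factorial : ℝ) ≠ 0 := by positivity
  have : (j : ℝ) + 1 ≠ 0 := by positivity
  push_cast
  field_simp

theorem risingCoeff_add_one (a : ℝ) (j : ℕ) :
    risingCoeff (a + 1) (j + 1) = risingCoeff (a + 1) j + risingCoeff a (j + 1) := by
  have h := risingCoeff_succ_shift a j
  have h2 : (j + 1 : ℝ) * risingCoeff (a + 1) (j + 1) = (a + 1 + j) * risingCoeff (a + 1) j := by
    rw [risingCoeff, risingCoeff, Finset.prod_range_succ, Nat.factorial_succ]
    have : (j.factorial : ℝ) ≠ 0 := by positivity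
    have : (j : ℝ) + 1 ≠ 0 := by positivity
    push_cast
    field_simp
  have h3 : (j : ℝ) + 1 ≠ 0 := by positivity
  apply mul_left_cancel₀ h3
  rw [mul_add, h, h2]
  ring

/-- Raising every exponent by one multiplies the generating function by $1/(1-w)$, that is, takes
partial sums of its coefficients. -/
theorem sum_mul_risingCoeff_add_one (t a : ℕ → ℝ) (m : ℕ) :
    ∑ k ∈ Finset.Icc 1 m, t k * risingCoeff (a k + 1) (m - k) =
      ∑ j ∈ Finset.Icc 1 m, ∑ k ∈ Finset.Icc 1 j, t k * risingCoeff (a k) (j - k) := by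
  induction m with
  | zero => simp
  | succ m ih =>
    have e := fun f : ℕ → ℝ => Finset.sum_Icc_succ_top (a := 1) (b := m) (by omega) f
    rw [e, e, ← ih, e, ← add_assoc, ← Finset.sum_add_distrib]
    congr 1
    · refine Finset.sum_congr rfl fun k hk => ?_
      rw [Finset.mem_Icc] at hk
      rw [show m + 1 - k = m - k + 1 by omega, risingCoeff_add_one]
      ring
    · rw [Nat.sub_self, risingCoeff_zero, risingCoeff_zero]

/-- Up to sign, the two products are adjacent stretches of one progression of $m-1$ terms. The
summand thus becomes a signed binomial coefficient times a polynomial in $k$ of degree below $m$. -/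
theorem lagrangeCoeff_mul_risingCoeff (x : ℝ) {k m : ℕ} (hk : 1 ≤ k) (hkm : k ≤ m) :
    lagrangeCoeff x k * risingCoeff (-(k * x)) (m - k) =
      (-1) ^ (m - k) * (m.choose k : ℝ) *
        (∏ i ∈ Finset.Ico 1 m, ((k : ℝ) * (x + 1) - m + i)) / m.factorial := by
  have h1 : ∏ i ∈ Finset.Ico 1 m, ((k : ℝ) * (x + 1) - m + i) =
      ((-1) ^ (m - k) * ∏ i ∈ Finset.range (m - k), (-(k * x) + i)) *
        ∏ i ∈ Finset.Ico 1 k, ((k : ℝ) * x + i) := by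
    rw [← Finset.prod_Ico_consecutive _ (show 1 ≤ m - k + 1 by omega)
      (show m - k + 1 ≤ m by omega)]
    congr 1
    · have hneg : ((-1 : ℝ) ^ (m - k)) = ∏ i ∈ Finset.range (m - k), (-1 : ℝ) := by simp
      rw [Finset.prod_Ico_eq_prod_range, ← Finset.prod_range_reflect, Nat.add_sub_cancel, hneg,
        ← Finset.prod_mul_distrib]
      refine Finset.prod_congr rfl fun i hi => ?_
      rw [Finset.mem_range] at hi
      have : ((1 + (m - k - 1 - i) : ℕ) : ℝ) = m - k - i := by
        rw [show 1 + (m - k - 1 - i) = m - k - i by omega, Nat.cast_sub (by omega),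
          Nat.cast_sub hkm]
      rw [this]
      ring
    · rw [show m = k + (m - k) by omega, show k + (m - k) - k + 1 = 1 + (m - k) by omega,
        ← Finset.prod_Ico_add']
      refine Finset.prod_congr rfl fun i _ => ?_
      push_cast [Nat.cast_sub hkm]
      ring
  have hs : ((-1 : ℝ) ^ (m - k)) * (-1) ^ (m - k) = 1 := by
    rw [← mul_pow]; norm_num
  rw [h1, lagrangeCoeff, risingCoeff, ← Nat.choose_mul_factorial_mul_factorial hkm]
  have c1 : (m.choose k : ℝ) ≠ 0 := by exact_mod_cast (Nat.choose_pos hkm).ne'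
  have c2 : (k.factorial : ℝ) ≠ 0 := by positivity
  have c3 : ((m - k).factorial : ℝ) ≠ 0 := by positivity
  push_cast
  field_simp
  linear_combination (-(∏ i ∈ Finset.Ico 1 k, ((k : ℝ) * x + i)) *
    (∏ i ∈ Finset.range (m - k), (-(k * x) + i))) * hs

theorem sum_choose_mul_prod_eq_zero (x : ℝ) {m : ℕ} (hm : 1 ≤ m) :
    ∑ k ∈ Finset.range (m + 1), (-1) ^ (m - k) * (m.choose k : ℝ) *
        (∏ i ∈ Finset.Ico 1 m, ((k : ℝ) * (x + 1) - m + i)) = 0 := by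
  set P : Polynomial ℝ := ∏ i ∈ Finset.Ico 1 m,
    (Polynomial.C (x + 1) * Polynomial.X + Polynomial.C (-(m : ℝ) + i)) with hP
  have hdeg : P.natDegree < m := by
    refine (Polynomial.natDegree_prod_le _ _).trans_lt ?_
    refine (Finset.sum_le_card_nsmul _ _ 1 fun i _ => Polynomial.natDegree_linear_le).trans_lt ?_
    simp
    omega
  have h := congrFun (Polynomial.fwdDiff_iter_eq_zero_of_degree_lt hdeg) 0
  rw [fwdDiff_iter_eq_sum_shift] at h
  rw [Pi.zero_apply] at h
  rw [← h]
  refine Finset.sum_congr rfl fun k _ => ?_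
  rw [zsmul_eq_mul]
  push_cast
  congr 1
  rw [hP, Polynomial.eval_prod]
  refine Finset.prod_congr rfl fun i _ => ?_
  simp
  ring

/-- This compares coefficients of $w^m$ in $\sum_k L_k u^k=-\log(1-w)$, with $L_k$ the
`lagrangeCoeff`. Extended to $k=0$, the sum is an $m$-th finite difference of a polynomial of
smaller degree, hence zero; the term $k=0$ is $-1/m$. -/
theorem sum_lagrangeCoeff_mul_risingCoeff_neg (x : ℝ) {m : ℕ} (hm : 1 ≤ m) :
    ∑ k ∈ Finset.Icc 1 m, lagrangeCoeff x k * risingCoeff (-(k * x)) (m - k) = 1 / m := by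
  have h := sum_choose_mul_prod_eq_zero x hm
  rw [Finset.range_eq_Ico, Finset.sum_eq_sum_Ico_succ_bot (by omega)] at h
  have h0 : ∏ i ∈ Finset.Ico 1 m, (((0 : ℕ) : ℝ) * (x + 1) - m + i) =
      (-1) ^ (m - 1) * ((m - 1).factorial : ℝ) := by
    rw [← Finset.prod_range_add_one_eq_factorial, Finset.prod_Ico_eq_prod_range,
      ← Finset.prod_range_reflect]
    have : ((-1 : ℝ) ^ (m - 1)) = ∏ i ∈ Finset.range (m - 1), (-1 : ℝ) := by simp
    rw [this]
    push_cast
    rw [← Finset.prod_mul_distrib]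
    refine Finset.prod_congr rfl fun i hi => ?_
    rw [Finset.mem_range] at hi
    have : ((m - 1 - 1 - i : ℕ) : ℝ) = m - 1 - 1 - i := by
      rw [Nat.cast_sub (by omega), Nat.cast_sub (by omega), Nat.cast_sub (by omega)]
      simp
    rw [this]
    ring
  rw [h0] at h
  have hIcc : Finset.Ico (0 + 1) (m + 1) = Finset.Icc 1 m := by
    ext i
    simp
  rw [hIcc] at h
  rw [Finset.sum_congr rfl fun k hk => lagrangeCoeff_mul_risingCoeff x (Finset.mem_Icc.1 hk).1
    (Finset.mem_Icc.1 hk).2, ← Finset.sum_div, eq_neg_of_add_eq_zero_right h]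
  obtain ⟨j, rfl⟩ : ∃ j, m = j + 1 := ⟨m - 1, by omega⟩
  have hs : ((-1 : ℝ) ^ j) * (-1) ^ j = 1 := by
    rw [← mul_pow]; norm_num
  rw [Nat.factorial_succ]
  simp only [Nat.sub_zero, Nat.add_sub_cancel, Nat.choose_zero_right]
  have : (j.factorial : ℝ) ≠ 0 := by positivity
  have : (j : ℝ) + 1 ≠ 0 := by positivity
  push_cast
  field_simp
  rw [pow_succ]
  linear_combination hs

/-- The harmonic numbers, as real numbers. -/
noncomputable def harmonicReal (m : ℕ) : ℝ := ∑ j ∈ Finset.Icc 1 m, 1 / (j : ℝ)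

theorem harmonicReal_succ (m : ℕ) : harmonicReal (m + 1) = harmonicReal m + 1 / (m + 1) := by
  rw [harmonicReal, Finset.sum_Icc_succ_top (by omega), harmonicReal]
  push_cast
  rfl

theorem sum_harmonicReal (m : ℕ) :
    ∑ j ∈ Finset.Icc 1 m, harmonicReal j = (m + 1) * harmonicReal m - m := by
  induction m with
  | zero => simp [harmonicReal]
  | succ m ih =>
    rw [Finset.sum_Icc_succ_top (by omega), ih, harmonicReal_succ]
    have : (m : ℝ) + 1 ≠ 0 := by positivity
    push_cast
    field_simp
    ring

theorem sum_lagrangeCoeff_mul_risingCoeff (x : ℝ) (m : ℕ) :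
    ∑ k ∈ Finset.Icc 1 m, lagrangeCoeff x k * risingCoeff (-(k * x) + 1) (m - k) =
      harmonicReal m := by
  rw [sum_mul_risingCoeff_add_one (lagrangeCoeff x) (fun k => -(k * x)), harmonicReal]
  exact Finset.sum_congr rfl fun j hj =>
    sum_lagrangeCoeff_mul_risingCoeff_neg x (Finset.mem_Icc.1 hj).1

theorem sum_lagrangeCoeff_mul_risingCoeff_two (x : ℝ) (m : ℕ) :
    ∑ k ∈ Finset.Icc 1 m, lagrangeCoeff x k * risingCoeff (-(k * x) + 1 + 1) (m - k) =
      (m + 1) * harmonicReal m - m := by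
  rw [sum_mul_risingCoeff_add_one (lagrangeCoeff x) (fun k => -(k * x) + 1), ← sum_harmonicReal]
  exact Finset.sum_congr rfl fun j _ => sum_lagrangeCoeff_mul_risingCoeff x j

/-- Write $1-mx=(1-kx)-x(m-k)$. The first part cancels the denominator; in the second, the factor
$m-k$ is absorbed by `risingCoeff_succ_shift`, which again produces $1-kx$. Two sums already
evaluated remain. -/
theorem sum_lagrangeCoeff_div_mul_risingCoeff (x : ℝ) (m : ℕ)
    (hx : ∀ k ∈ Finset.Icc 1 m, 1 - (k : ℝ) * x ≠ 0) :
    (1 - m * x) * ∑ k ∈ Finset.Icc 1 m,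
        lagrangeCoeff x k / (1 - k * x) * risingCoeff (1 - k * x) (m - k) =
      (1 - m * x) * (harmonicReal m - 1) + 1 := by
  cases m with
  | zero => simp [harmonicReal]
  | succ m =>
    have h1 := sum_lagrangeCoeff_mul_risingCoeff x (m + 1)
    have h2 := sum_lagrangeCoeff_mul_risingCoeff_two x m
    have h3 : (1 - ((m + 1 : ℕ) : ℝ) * x) * ∑ k ∈ Finset.Icc 1 (m + 1),
        lagrangeCoeff x k / (1 - k * x) * risingCoeff (1 - k * x) (m + 1 - k) =
        ∑ k ∈ Finset.Icc 1 (m + 1), lagrangeCoeff x k * risingCoeff (-(k * x) + 1) (m + 1 - k) -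
        x * ∑ k ∈ Finset.Icc 1 m,
          lagrangeCoeff x k * risingCoeff (-(k * x) + 1 + 1) (m - k) := by
      -- The top index contributes to the first sum only, since its weight $m+1-k$ in the second is
      -- zero.
      rw [Finset.sum_Icc_succ_top (by omega), Finset.sum_Icc_succ_top (by omega), Nat.sub_self,
        risingCoeff_zero, risingCoeff_zero, mul_add, Finset.mul_sum, Finset.mul_sum,
        add_sub_right_comm, ← Finset.sum_sub_distrib]
      congr 1
      · refine Finset.sum_congr rfl fun k hk => ?_
        have hk' := Finset.mem_Icc.1 hk
        have ha := hx k (Finset.mem_Icc.2 ⟨hk'.1, by omega⟩)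
        have h4 := risingCoeff_succ_shift (1 - k * x) (m - k)
        rw [show m + 1 - k = m - k + 1 by omega, show -((k : ℝ) * x) + 1 = 1 - k * x by ring]
        rw [Nat.cast_sub hk'.2] at h4
        generalize risingCoeff (1 - k * x) (m - k + 1) = p at h4 ⊢
        generalize risingCoeff (1 - k * x + 1) (m - k) = q at h4 ⊢
        push_cast
        rw [div_mul_eq_mul_div, mul_div_assoc', div_eq_iff ha]
        linear_combination (-x * lagrangeCoeff x k) * h4
      · have ha := hx (m + 1) (Finset.mem_Icc.2 ⟨by omega, le_rfl⟩)
        field_simp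
    rw [h3, h1, h2, harmonicReal_succ]
    have : (m : ℝ) + 1 ≠ 0 := by positivity
    push_cast
    field_simp
    ring

theorem risingCoeff_eq_mul_lagrangeCoeff (x : ℝ) {j : ℕ} (hj : 1 ≤ j) :
    risingCoeff (j * x) j = j * x * lagrangeCoeff x j := by
  obtain ⟨i, rfl⟩ : ∃ i, j = i + 1 := ⟨j - 1, by omega⟩
  rw [risingCoeff, lagrangeCoeff, Finset.range_eq_Ico, Finset.prod_eq_prod_Ico_succ_bot (by omega)]
  simp
  ring

theorem lagrangeCoeff_inv_self {ℓ : ℕ} (hℓ : 1 ≤ ℓ) : lagrangeCoeff (1 / ℓ) ℓ = 1 := by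
  have h : (ℓ : ℝ) ≠ 0 := by positivity
  obtain ⟨i, rfl⟩ : ∃ i, ℓ = i + 1 := ⟨ℓ - 1, by omega⟩
  rw [lagrangeCoeff, mul_one_div_cancel h, div_eq_one_iff_eq (by positivity),
    ← Finset.prod_range_add_one_eq_factorial, Finset.prod_range_succ', Finset.prod_Ico_eq_prod_range]
  push_cast
  simp only [mul_one]
  exact Finset.prod_congr rfl fun j _ => by ring

/-- For $m=\ell$, $x=1/\ell$ the preceding identity degenerates. But $1-kx=(\ell-k)x$ turns the
summand into $L_kL_{\ell-k}$. By symmetry the weights $kx$ and $(\ell-k)x$, which add to 1, give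
equal sums, and the latter is the harmonic identity with its term $L_\ell=1$ removed. -/
theorem sum_lagrangeCoeff_critical {ℓ : ℕ} (hℓ : 1 ≤ ℓ) :
    ∑ k ∈ Finset.Ico 1 ℓ, lagrangeCoeff (1 / ℓ) k / (1 - k * (1 / ℓ)) *
        risingCoeff (1 - k * (1 / ℓ)) (ℓ - k) = 2 * (harmonicReal ℓ - 1) := by
  have hl : (ℓ : ℝ) ≠ 0 := by positivity
  set x : ℝ := 1 / ℓ with hx
  have hlx : (ℓ : ℝ) * x = 1 := mul_one_div_cancel hl
  have ha : ∀ k ∈ Finset.Ico 1 ℓ, 1 - (k : ℝ) * x = ((ℓ - k : ℕ) : ℝ) * x := fun k hk => by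
    rw [Nat.cast_sub (Finset.mem_Ico.1 hk).2.le]
    linear_combination -hlx
  have h1 : ∀ k ∈ Finset.Ico 1 ℓ, lagrangeCoeff x k / (1 - k * x) *
      risingCoeff (1 - k * x) (ℓ - k) = lagrangeCoeff x k * lagrangeCoeff x (ℓ - k) := by
    intro k hk
    have hk' := Finset.mem_Ico.1 hk
    rw [ha k hk, risingCoeff_eq_mul_lagrangeCoeff x (by omega)]
    have : ((ℓ - k : ℕ) : ℝ) ≠ 0 := by
      have : 0 < ℓ - k := by omega
      positivity
    have : x ≠ 0 := by positivity
    field_simp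
  have h2 : ∑ k ∈ Finset.Ico 1 ℓ, lagrangeCoeff x k * lagrangeCoeff x (ℓ - k) * (k * x) =
      ∑ k ∈ Finset.Ico 1 ℓ,
        lagrangeCoeff x k * lagrangeCoeff x (ℓ - k) * (((ℓ - k : ℕ) : ℝ) * x) := by
    refine Finset.sum_nbij' (fun k => ℓ - k) (fun k => ℓ - k) ?_ ?_ ?_ ?_ ?_
    · intro k hk; simp only [Finset.mem_Ico] at *; omega
    · intro k hk; simp only [Finset.mem_Ico] at *; omega
    · intro k hk; simp only [Finset.mem_Ico] at *; omega
    · intro k hk; simp only [Finset.mem_Ico] at *; omega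
    · intro k hk
      simp only [Finset.mem_Ico] at *
      rw [show ℓ - (ℓ - k) = k by omega]
      ring
  have h3 : ∑ k ∈ Finset.Ico 1 ℓ,
      lagrangeCoeff x k * lagrangeCoeff x (ℓ - k) * (((ℓ - k : ℕ) : ℝ) * x) =
        harmonicReal ℓ - 1 := by
    have h := sum_lagrangeCoeff_mul_risingCoeff x ℓ
    have hIcc : Finset.Icc 1 ℓ = insert ℓ (Finset.Ico 1 ℓ) := by
      ext i
      simp
      omega
    rw [hIcc, Finset.sum_insert (by simp), Nat.sub_self, risingCoeff_zero,
      lagrangeCoeff_inv_self hℓ] at h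
    rw [← h]
    simp only [mul_one, add_sub_cancel_left]
    refine Finset.sum_congr rfl fun k hk => ?_
    have hk' := Finset.mem_Ico.1 hk
    rw [show -((k : ℝ) * x) + 1 = 1 - k * x by ring, ha k hk,
      risingCoeff_eq_mul_lagrangeCoeff x (by omega)]
    ring
  rw [Finset.sum_congr rfl h1, two_mul, ← h3]
  nth_rewrite 1 [← h2]
  rw [← Finset.sum_add_distrib]
  refine Finset.sum_congr rfl fun k hk => ?_
  rw [← ha k hk]
  ring

/-! ### Taylor expansions of powers and logarithms of $1-w$. -/

theorem ascPochhammer_eval_eq_prod (a : ℝ) (n : ℕ) :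
    (ascPochhammer ℝ n).eval a = ∏ i ∈ Finset.range n, (a + i) := by
  induction n with
  | zero => simp
  | succ n ih => rw [ascPochhammer_succ_eval, ih, Finset.prod_range_succ]

theorem ringChoose_eq_risingCoeff (a : ℝ) (n : ℕ) :
    Ring.choose (a + n - 1) n = risingCoeff a n := by
  have h := Ring.factorial_nsmul_multichoose_eq_ascPochhammer a n
  rw [Polynomial.ascPochhammer_smeval_eq_eval, ascPochhammer_eval_eq_prod, nsmul_eq_mul] at h
  rw [← Ring.multichoose_eq, risingCoeff, ← h, mul_div_cancel_left₀]
  positivity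

theorem one_div_one_sub_rpow_sub_isBigO (a : ℝ) (n : ℕ) :
    (fun w : ℝ => 1 / (1 - w) ^ a - ∑ j ∈ Finset.range n, risingCoeff a j * w ^ j)
      =O[nhds 0] fun w => w ^ n := by
  have h := (Real.one_div_one_sub_rpow_hasFPowerSeriesOnBall_zero
    a).hasFPowerSeriesAt.isBigO_sub_partialSum_pow n
  simp only [zero_add] at h
  refine (h.congr_left fun w => ?_).trans (isBigO_of_le _ fun w => by simp)
  congr 1
  rw [FormalMultilinearSeries.partialSum]
  refine Finset.sum_congr rfl fun j _ => ?_
  rw [FormalMultilinearSeries.ofScalars_apply_eq, ringChoose_eq_risingCoeff, smul_eq_mul]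

theorem neg_log_one_sub_sub_isBigO (n : ℕ) :
    (fun w : ℝ => -Real.log (1 - w) - ∑ j ∈ Finset.Icc 1 n, w ^ j / j)
      =O[nhds 0] fun w => w ^ (n + 1) := by
  refine IsBigO.of_bound 2 ?_
  have hlt : ∀ᶠ w : ℝ in nhds 0, |w| < 1 / 2 := by
    have := (continuous_abs (G := ℝ)).tendsto 0
    rw [abs_zero] at this
    exact this.eventually (gt_mem_nhds (by norm_num))
  filter_upwards [hlt] with w hw
  have h := Real.abs_log_sub_add_sum_range_le (show |w| < 1 by linarith) n
  have h1 : ∑ j ∈ Finset.Icc 1 n, w ^ j / (j : ℝ) =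
      ∑ i ∈ Finset.range n, w ^ (i + 1) / ((i : ℝ) + 1) := by
    have h2 := Finset.sum_Ico_add' (fun j : ℕ => w ^ j / (j : ℝ)) 0 n 1
    push_cast at h2
    rw [Finset.range_eq_Ico, h2]
    refine Finset.sum_congr ?_ fun _ _ => rfl
    ext j
    simp only [Finset.mem_Icc, Finset.mem_Ico]
    omega
  rw [h1, Real.norm_eq_abs, norm_pow, Real.norm_eq_abs, ← abs_neg]
  refine (le_of_eq (by ring_nf)).trans (h.trans ?_)
  rw [div_le_iff₀ (by linarith)]
  nlinarith [pow_nonneg (abs_nonneg w) (n + 1)]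

theorem one_sub_mul_sum_harmonicReal (w : ℝ) (n : ℕ) :
    (1 - w) * ∑ m ∈ Finset.range (n + 1), harmonicReal m * w ^ m =
      ∑ j ∈ Finset.Icc 1 n, w ^ j / j - harmonicReal n * w ^ (n + 1) := by
  induction n with
  | zero => simp [harmonicReal]
  | succ n ih =>
    rw [Finset.sum_range_succ, mul_add, ih, Finset.sum_Icc_succ_top (by omega), harmonicReal_succ]
    push_cast
    ring

theorem neg_log_div_one_sub_sub_isBigO (n : ℕ) :
    (fun w : ℝ => -Real.log (1 - w) / (1 - w) -
      ∑ m ∈ Finset.range (n + 1), harmonicReal m * w ^ m) =O[nhds 0] fun w => w ^ (n + 1) := by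
  have hT : (fun w : ℝ => (1 - w)⁻¹) =O[nhds 0] fun _ => (1 : ℝ) := by
    have : ContinuousAt (fun w : ℝ => (1 - w)⁻¹) 0 :=
      (continuousAt_const.sub continuousAt_id).inv₀ (by norm_num)
    exact this.isBigO_one ℝ
  have h1 := (hT.mul (neg_log_one_sub_sub_isBigO n)).add
    (hT.mul ((isBigO_refl (fun w : ℝ => w ^ (n + 1)) (nhds 0)).const_mul_left (harmonicReal n)))
  simp only [one_mul] at h1
  refine h1.congr' ?_ EventuallyEq.rfl
  filter_upwards [gt_mem_nhds (show (0 : ℝ) < 1 by norm_num)] with w hw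
  have hw' : 1 - w ≠ 0 := by linarith
  have h2 := one_sub_mul_sum_harmonicReal w n
  field_simp
  linear_combination h2

/-! ### Expansion of the exponent in $w=1/r$. -/

/-- The saddle point exponent, divided by `w ^ (-ℓ)` at the radius `1 / w`, in terms of the values
`s` of `∑ i < ℓ, w ^ i` and `y` of `s * log s`, `v k` of `s ^ (1 - k / ℓ)`. -/
noncomputable def scaledExponent (ℓ : ℕ) (w s y : ℝ) (v : ℕ → ℝ) : ℝ :=
  ∑ i ∈ Finset.range ℓ, w ^ i / ((ℓ : ℝ) - i) + 1 / ℓ * (y - s) -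
    ∑ k ∈ Finset.Ico 1 ℓ, lagrangeCoeff (1 / ℓ) k / ((ℓ : ℝ) - k) * (w ^ k * v k)

/-- Regrouping by total degree; degree $\ell$ stands apart because $k=\ell$ is missing there. -/
theorem sum_sum_range_eq (ℓ : ℕ) (f : ℕ → ℕ → ℝ) :
    ∑ k ∈ Finset.Ico 1 ℓ, ∑ j ∈ Finset.range (ℓ + 1 - k), f k (k + j) =
      ∑ m ∈ Finset.range ℓ, ∑ k ∈ Finset.Icc 1 m, f k m + ∑ k ∈ Finset.Ico 1 ℓ, f k ℓ := by
  have h1 : ∀ k ∈ Finset.Ico 1 ℓ, ∑ j ∈ Finset.range (ℓ + 1 - k), f k (k + j) =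
      ∑ m ∈ Finset.range ℓ, (if k ≤ m then f k m else 0) + f k ℓ := by
    intro k hk
    have hk' := Finset.mem_Ico.1 hk
    rw [← Finset.sum_Ico_eq_sum_range (fun m => f k m), Finset.sum_Ico_succ_top hk'.2.le,
      ← Finset.sum_filter]
    congr 1
    refine Finset.sum_congr ?_ fun _ _ => rfl
    ext m
    simp only [Finset.mem_Ico, Finset.mem_filter, Finset.mem_range]
    omega
  rw [Finset.sum_congr rfl h1, Finset.sum_add_distrib, Finset.sum_comm]
  congr 1
  refine Finset.sum_congr rfl fun m hm => ?_
  have hm' := Finset.mem_range.1 hm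
  rw [← Finset.sum_filter]
  refine Finset.sum_congr ?_ fun _ _ => rfl
  ext k
  simp only [Finset.mem_Ico, Finset.mem_filter, Finset.mem_Icc]
  omega

/-- Below degree $\ell$ the coefficients cancel by `sum_lagrangeCoeff_div_mul_risingCoeff`. In
degree $\ell$ the logarithm contributes $(H_\ell-1)/\ell$ and the critical sum subtracts twice that.
-/
theorem truncated_scaledExponent {ℓ : ℕ} (hℓ : 1 ≤ ℓ) (w : ℝ) :
    ∑ i ∈ Finset.range ℓ, w ^ i / ((ℓ : ℝ) - i) +
      1 / ℓ * (∑ m ∈ Finset.range (ℓ + 1), harmonicReal m * w ^ m -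
        ∑ m ∈ Finset.range (ℓ + 1), w ^ m) -
    ∑ k ∈ Finset.Ico 1 ℓ, lagrangeCoeff (1 / ℓ) k / ((ℓ : ℝ) - k) *
      (w ^ k * ∑ j ∈ Finset.range (ℓ + 1 - k), risingCoeff (1 - k * (1 / ℓ)) j * w ^ j) =
    -((harmonicReal ℓ - 1) / ℓ) * w ^ ℓ := by
  have hl : (ℓ : ℝ) ≠ 0 := by positivity
  have hlx : (ℓ : ℝ) * (1 / ℓ) = 1 := mul_one_div_cancel hl
  set x : ℝ := 1 / ℓ with hx
  have hne : ∀ k : ℕ, k < ℓ → (ℓ : ℝ) - k ≠ 0 := fun k hk => by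
    have : (k : ℝ) < ℓ := by exact_mod_cast hk
    linarith
  have hfac : ∀ k : ℕ, 1 - (k : ℝ) * x = x * ((ℓ : ℝ) - k) := fun k => by
    linear_combination -hlx
  have hx0 : x ≠ 0 := by positivity
  have hc : ∀ k : ℕ, lagrangeCoeff x k / ((ℓ : ℝ) - k) =
      x * (lagrangeCoeff x k / (1 - k * x)) := fun k => by
    rw [hfac, mul_div_assoc', mul_div_mul_left _ _ hx0]
  have hdouble : ∑ k ∈ Finset.Ico 1 ℓ, lagrangeCoeff x k / ((ℓ : ℝ) - k) *
      (w ^ k * ∑ j ∈ Finset.range (ℓ + 1 - k), risingCoeff (1 - k * x) j * w ^ j) =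
      x * ∑ k ∈ Finset.Ico 1 ℓ, ∑ j ∈ Finset.range (ℓ + 1 - k),
        lagrangeCoeff x k / (1 - k * x) * risingCoeff (1 - k * x) (k + j - k) * w ^ (k + j) := by
    rw [Finset.mul_sum]
    refine Finset.sum_congr rfl fun k _ => ?_
    rw [hc, Finset.mul_sum, Finset.mul_sum, Finset.mul_sum]
    refine Finset.sum_congr rfl fun j _ => ?_
    rw [Nat.add_sub_cancel_left, pow_add]
    ring
  rw [hdouble, sum_sum_range_eq ℓ
    (fun k m => lagrangeCoeff x k / (1 - k * x) * risingCoeff (1 - k * x) (m - k) * w ^ m)]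
  have hcrit := sum_lagrangeCoeff_critical hℓ
  rw [← hx] at hcrit
  rw [← Finset.sum_mul, hcrit, Finset.sum_range_succ, Finset.sum_range_succ]
  have hlow : ∀ m ∈ Finset.range ℓ, ∑ k ∈ Finset.Icc 1 m,
      lagrangeCoeff x k / (1 - k * x) * risingCoeff (1 - k * x) (m - k) * w ^ m =
      (harmonicReal m - 1) * w ^ m + ℓ * (w ^ m / ((ℓ : ℝ) - m)) := by
    intro m hm
    have hm' := Finset.mem_range.1 hm
    have h := sum_lagrangeCoeff_div_mul_risingCoeff x m (fun k hk => by
      rw [hfac]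
      exact mul_ne_zero hx0 (hne k (by have := (Finset.mem_Icc.1 hk).2; omega)))
    have hm0 : 1 - (m : ℝ) * x ≠ 0 := by
      rw [hfac]
      exact mul_ne_zero hx0 (hne m hm')
    have h2 : (1 - (m : ℝ) * x) * (ℓ / ((ℓ : ℝ) - m)) = 1 := by
      rw [hfac]
      have := hne m hm'
      field_simp
      linear_combination hlx
    rw [← Finset.sum_mul]
    apply mul_left_cancel₀ hm0
    rw [← mul_assoc, h]
    linear_combination (-w ^ m) * h2
  rw [Finset.sum_congr rfl hlow, Finset.sum_add_distrib, ← Finset.mul_sum]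
  simp only [sub_mul, Finset.sum_sub_distrib, one_mul]
  linear_combination (-∑ i ∈ Finset.range ℓ, w ^ i / ((ℓ : ℝ) - i)) * hlx

theorem scaledExponent_geometric_isBigO {ℓ : ℕ} (hℓ : 1 ≤ ℓ) :
    (fun w : ℝ => scaledExponent ℓ w (1 - w)⁻¹ (-Real.log (1 - w) / (1 - w))
        (fun k => 1 / (1 - w) ^ (1 - k * (1 / ℓ : ℝ))) - -((harmonicReal ℓ - 1) / ℓ) * w ^ ℓ)
      =O[nhds 0] fun w => w ^ (ℓ + 1) := by
  have h1 := neg_log_div_one_sub_sub_isBigO ℓ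
  have h2 := one_div_one_sub_rpow_sub_isBigO 1 (ℓ + 1)
  have hone : ∀ j, risingCoeff 1 j = 1 := fun j => by
    rw [risingCoeff, div_eq_one_iff_eq (by positivity), ← Finset.prod_range_add_one_eq_factorial]
    push_cast
    exact Finset.prod_congr rfl fun i _ => by ring
  simp only [Real.rpow_one, hone, one_mul, one_div] at h2
  have h3 : (fun w : ℝ => ∑ k ∈ Finset.Ico 1 ℓ, lagrangeCoeff (1 / ℓ) k / ((ℓ : ℝ) - k) *
      (w ^ k * (1 / (1 - w) ^ (1 - k * (1 / ℓ : ℝ)) -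
        ∑ j ∈ Finset.range (ℓ + 1 - k), risingCoeff (1 - k * (1 / ℓ)) j * w ^ j)))
      =O[nhds 0] fun w => w ^ (ℓ + 1) := by
    refine IsBigO.fun_sum fun k hk => IsBigO.const_mul_left ?_ _
    have hk' := Finset.mem_Ico.1 hk
    have := (isBigO_refl (fun w : ℝ => w ^ k) (nhds 0)).mul
      (one_div_one_sub_rpow_sub_isBigO (1 - k * (1 / ℓ)) (ℓ + 1 - k))
    refine this.congr_right fun w => ?_
    rw [← pow_add]
    congr 1
    omega
  refine (((h1.sub h2).const_mul_left (1 / (ℓ : ℝ))).sub h3).congr_left fun w => ?_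
  rw [← truncated_scaledExponent hℓ w, scaledExponent]
  simp only [mul_sub, Finset.sum_sub_distrib]
  ring

/-- The finite and infinite geometric sums differ by $O(w^\ell)$, so only first-order effects of
exchanging them could matter, and the two steps `hphi` and `hpow` show that these vanish. -/
theorem scaledExponent_isLittleO {ℓ : ℕ} (hℓ : 1 ≤ ℓ) :
    (fun w : ℝ => scaledExponent ℓ w (∑ i ∈ Finset.range ℓ, w ^ i)
        ((∑ i ∈ Finset.range ℓ, w ^ i) * Real.log (∑ i ∈ Finset.range ℓ, w ^ i))
        (fun k => (∑ i ∈ Finset.range ℓ, w ^ i) ^ (1 - k * (1 / ℓ : ℝ))) -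
          -((harmonicReal ℓ - 1) / ℓ) * w ^ ℓ) =o[nhds 0] fun w => w ^ ℓ := by
  set S : ℝ → ℝ := fun w => ∑ i ∈ Finset.range ℓ, w ^ i with hS
  set T : ℝ → ℝ := fun w => (1 - w)⁻¹ with hT
  have hTc : ContinuousAt T 0 := (continuousAt_const.sub continuousAt_id).inv₀ (by norm_num)
  have hT0 : T 0 = 1 := by simp [hT]
  have hSc : ContinuousAt S 0 := by
    have : Continuous S := by fun_prop
    exact this.continuousAt
  have hS0 : S 0 = 1 := by
    obtain ⟨m, rfl⟩ : ∃ m, ℓ = m + 1 := ⟨ℓ - 1, by omega⟩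
    simp [hS, Finset.sum_range_succ']
  have hlim : Tendsto (fun w => (S w, T w)) (nhds 0) (nhds (1, 1)) := by
    have := hSc.prodMk hTc
    rw [ContinuousAt, hS0, hT0] at this
    exact this
  have hlt : ∀ᶠ w : ℝ in nhds 0, w < 1 := gt_mem_nhds (by norm_num)
  have hST : (fun w => S w - T w) =O[nhds 0] fun w => w ^ ℓ := by
    have h := ((hTc.isBigO_one ℝ).neg_left).mul (isBigO_refl (fun w : ℝ => w ^ ℓ) (nhds 0))
    simp only [one_mul] at h
    refine h.congr' ?_ EventuallyEq.rfl
    filter_upwards [hlt] with w hw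
    have h2 := geom_sum_eq hw.ne ℓ
    have h3 : w - 1 ≠ 0 := by linarith
    have h4 : 1 - w ≠ 0 := by linarith
    simp only [hS, hT, h2]
    field_simp
    ring
  have hsucc : (fun w : ℝ => w ^ (ℓ + 1)) =o[nhds 0] fun w => w ^ ℓ :=
    isLittleO_pow_pow (by omega)
  have hphi : (fun w => (S w * Real.log (S w) - S w) - (T w * Real.log (T w) - T w))
      =o[nhds 0] fun w => w ^ ℓ := by
    -- The point $s=1$ is critical for $s\log s-s$; strict differentiability allows both arguments
    -- to move.
    have hd : HasStrictDerivAt (fun s : ℝ => s * Real.log s - s) 0 1 := by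
      have := ((hasStrictDerivAt_id (1 : ℝ)).mul (Real.hasStrictDerivAt_log one_ne_zero)).sub
        (hasStrictDerivAt_id (1 : ℝ))
      rw [Real.log_one, inv_one, id_eq, mul_zero, zero_add, mul_one, sub_self] at this
      exact this
    have h := (hasFDerivAtFilter_iff_isLittleO.1 hd.hasStrictFDerivAt).comp_tendsto hlim
    refine (h.congr_left fun w => ?_).trans_isBigO hST
    simp
  have hpow : (fun w => ∑ k ∈ Finset.Ico 1 ℓ, lagrangeCoeff (1 / ℓ) k / ((ℓ : ℝ) - k) *
      (w ^ k * (S w ^ (1 - k * (1 / ℓ : ℝ)) - T w ^ (1 - k * (1 / ℓ : ℝ)))))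
      =o[nhds 0] fun w => w ^ ℓ := by
    refine IsLittleO.fun_sum fun k hk => IsLittleO.const_mul_left ?_ _
    have hk' := Finset.mem_Ico.1 hk
    have hd := Real.hasStrictDerivAt_rpow_const_of_ne (one_ne_zero (α := ℝ))
      (1 - k * (1 / ℓ : ℝ))
    have h := (hd.isBigO_sub.comp_tendsto hlim).trans hST
    -- The prefactor $w^k$ with $k\ge1$ supplies the extra smallness.
    have h0 : (fun w : ℝ => w ^ k) =o[nhds 0] fun _ => (1 : ℝ) := by
      have := isLittleO_pow_pow (𝕜 := ℝ) (m := 0) (n := k) (by omega)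
      simpa using this
    have := h0.mul_isBigO h
    simpa using this
  refine ((((scaledExponent_geometric_isBigO hℓ).trans_isLittleO hsucc).add
    (hphi.const_mul_left (1 / (ℓ : ℝ)))).sub hpow).congr' ?_ EventuallyEq.rfl
  filter_upwards [hlt] with w hw
  have h4 : 0 < 1 - w := by linarith
  have hlog : T w * Real.log (T w) = -Real.log (1 - w) / (1 - w) := by
    simp only [hT, Real.log_inv]
    ring
  have hpw : ∀ k : ℕ, T w ^ (1 - k * (1 / ℓ : ℝ)) = 1 / (1 - w) ^ (1 - k * (1 / ℓ : ℝ)) :=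
    fun k => by
      simp only [hT]
      rw [Real.inv_rpow h4.le, one_div ((1 - w) ^ _)]
  simp only [scaledExponent, ← hpw, ← hlog, mul_sub, Finset.sum_sub_distrib]
  ring

theorem sum_Icc_mul_pow_eq (ℓ : ℕ) (f : ℕ → ℝ) {r : ℝ} (hr : r ≠ 0) :
    ∑ j ∈ Finset.Icc 1 ℓ, f j * r ^ j =
      r ^ ℓ * ∑ i ∈ Finset.range ℓ, f (ℓ - i) * (1 / r) ^ i := by
  rw [Finset.mul_sum]
  refine Finset.sum_nbij' (fun j => ℓ - j) (fun i => ℓ - i) ?_ ?_ ?_ ?_ ?_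
  · intro j hj; simp only [Finset.mem_Icc, Finset.mem_range] at *; omega
  · intro j hj; simp only [Finset.mem_Icc, Finset.mem_range] at *; omega
  · intro j hj; simp only [Finset.mem_Icc] at *; omega
  · intro j hj; simp only [Finset.mem_range] at *; omega
  · intro j hj
    simp only [Finset.mem_Icc] at hj
    have h1 : r ^ ℓ = r ^ j * r ^ (ℓ - j) := by rw [← pow_add]; congr 1; omega
    rw [show ℓ - (ℓ - j) = j by omega, h1, one_div, inv_pow]
    field_simp

theorem exponent_eq_scaledExponent {ℓ : ℕ} (hℓ : 1 ≤ ℓ) {r N : ℝ} (hr : 0 < r)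
    (hN : ∑ j ∈ Finset.Icc 1 ℓ, r ^ j = N) :
    cyclePoly ℓ r - N * Real.log r + N / ℓ * Real.log N - N / ℓ -
        ∑ k ∈ Finset.Ico 1 ℓ, lagrangeCoeff (1 / ℓ) k / ((ℓ : ℝ) - k) *
          N ^ (((ℓ : ℝ) - k) / ℓ) =
      r ^ ℓ * scaledExponent ℓ (1 / r) (∑ i ∈ Finset.range ℓ, (1 / r) ^ i)
        ((∑ i ∈ Finset.range ℓ, (1 / r) ^ i) * Real.log (∑ i ∈ Finset.range ℓ, (1 / r) ^ i))
        (fun k => (∑ i ∈ Finset.range ℓ, (1 / r) ^ i) ^ (1 - k * (1 / ℓ : ℝ))) := by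
  have hl : (ℓ : ℝ) ≠ 0 := by positivity
  set S := ∑ i ∈ Finset.range ℓ, (1 / r) ^ i with hS
  have hSpos : 0 < S := Finset.sum_pos (fun i _ => by positivity) (by simp; omega)
  have hNS : N = r ^ ℓ * S := by
    have := sum_Icc_mul_pow_eq ℓ (fun _ => 1) hr.ne'
    simp only [one_mul] at this
    rw [← hN, this]
  have hP : cyclePoly ℓ r = r ^ ℓ * ∑ i ∈ Finset.range ℓ, (1 / r) ^ i / ((ℓ : ℝ) - i) := by
    have := sum_Icc_mul_pow_eq ℓ (fun j => 1 / (j : ℝ)) hr.ne'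
    simp only [one_div_mul_eq_div] at this
    rw [cyclePoly, this]
    congr 1
    refine Finset.sum_congr rfl fun i hi => ?_
    rw [Nat.cast_sub (Finset.mem_range.1 hi).le]
  have hlog : Real.log N = ℓ * Real.log r + Real.log S := by
    rw [hNS, Real.log_mul (by positivity) hSpos.ne', Real.log_pow]
  have hpow : ∀ k ∈ Finset.Ico 1 ℓ, N ^ (((ℓ : ℝ) - k) / ℓ) =
      r ^ ℓ * ((1 / r) ^ k * S ^ (1 - k * (1 / ℓ : ℝ))) := fun k hk => by
    have hk' := (Finset.mem_Ico.1 hk).2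
    rw [hNS, Real.mul_rpow (by positivity) hSpos.le, ← Real.rpow_natCast, ← Real.rpow_mul hr.le,
      mul_div_cancel₀ _ hl, Real.rpow_sub hr, Real.rpow_natCast, Real.rpow_natCast,
      show ((ℓ : ℝ) - k) / ℓ = 1 - k * (1 / ℓ) by field_simp, one_div_pow]
    ring
  have hsum : ∑ k ∈ Finset.Ico 1 ℓ, lagrangeCoeff (1 / ℓ) k / ((ℓ : ℝ) - k) *
      N ^ (((ℓ : ℝ) - k) / ℓ) = r ^ ℓ * ∑ k ∈ Finset.Ico 1 ℓ,
        lagrangeCoeff (1 / ℓ) k / ((ℓ : ℝ) - k) * ((1 / r) ^ k * S ^ (1 - k * (1 / ℓ : ℝ))) := by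
    rw [Finset.mul_sum]
    refine Finset.sum_congr rfl fun k hk => ?_
    rw [hpow k hk]
    ring
  rw [hsum, hlog, hP, scaledExponent, hNS]
  field_simp
  ring

/-! ### Limits along the saddle points. -/

theorem tendsto_exponent {ℓ : ℕ} (hℓ : 1 ≤ ℓ) {ρ : ℕ → ℝ} (hρ : Tendsto ρ atTop atTop)
    (hsaddle : ∀ᶠ n : ℕ in atTop, ∑ j ∈ Finset.Icc 1 ℓ, ρ n ^ j = n) :
    Tendsto (fun n : ℕ => cyclePoly ℓ (ρ n) - n * Real.log (ρ n) + n / ℓ * Real.log n - n / ℓ -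
        ∑ k ∈ Finset.Ico 1 ℓ, lagrangeCoeff (1 / ℓ) k / ((ℓ : ℝ) - k) *
          (n : ℝ) ^ (((ℓ : ℝ) - k) / ℓ)) atTop (nhds (-((harmonicReal ℓ - 1) / ℓ))) := by
  have hw : Tendsto (fun n => 1 / ρ n) atTop (nhds 0) := hρ.const_div_atTop 1
  have h := ((scaledExponent_isLittleO hℓ).comp_tendsto hw).tendsto_div_nhds_zero
  have h2 := h.add_const (-((harmonicReal ℓ - 1) / ℓ))
  rw [zero_add] at h2
  refine h2.congr' ?_
  filter_upwards [hsaddle, hρ.eventually_gt_atTop 0] with n hn h0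
  rw [exponent_eq_scaledExponent hℓ h0 hn]
  simp only [Function.comp_apply]
  have h1 : (1 / ρ n) ^ ℓ = (ρ n ^ ℓ)⁻¹ := by rw [one_div, inv_pow]
  rw [h1, div_inv_eq_mul]
  have : ρ n ^ ℓ ≠ 0 := by positivity
  field_simp
  ring

/-- Both $n$ and the variance are $\rho^\ell$ times a polynomial in $1/\rho$, with constant terms 1
and $\ell$. -/
theorem tendsto_variance_ratio {ℓ : ℕ} (hℓ : 1 ≤ ℓ) {ρ : ℕ → ℝ} (hρ : Tendsto ρ atTop atTop)
    (hsaddle : ∀ᶠ n : ℕ in atTop, ∑ j ∈ Finset.Icc 1 ℓ, ρ n ^ j = n) :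
    Tendsto (fun n : ℕ => ℓ * n / saddleVariance ℓ (ρ n)) atTop (nhds 1) := by
  have hl : (ℓ : ℝ) ≠ 0 := by positivity
  have hw : Tendsto (fun n => 1 / ρ n) atTop (nhds 0) := hρ.const_div_atTop 1
  have hc : ∀ f : ℕ → ℝ, Tendsto (fun n => ∑ i ∈ Finset.range ℓ, f (ℓ - i) * (1 / ρ n) ^ i)
      atTop (nhds (f ℓ)) := by
    intro f
    have hcont : Continuous (fun w : ℝ => ∑ i ∈ Finset.range ℓ, f (ℓ - i) * w ^ i) := by fun_prop
    have h := (hcont.tendsto 0).comp hw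
    have h0 : ∑ i ∈ Finset.range ℓ, f (ℓ - i) * (0 : ℝ) ^ i = f ℓ := by
      obtain ⟨m, rfl⟩ : ∃ m, ℓ = m + 1 := ⟨ℓ - 1, by omega⟩
      simp [Finset.sum_range_succ']
    rw [h0] at h
    exact h
  have h := ((hc fun _ => 1).const_mul (ℓ : ℝ)).div (hc fun j => (j : ℝ)) hl
  rw [mul_one, div_self hl] at h
  refine h.congr' ?_
  filter_upwards [hsaddle, hρ.eventually_gt_atTop 0] with n hn h0
  have h1 := sum_Icc_mul_pow_eq ℓ (fun _ => 1) h0.ne'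
  have h2 := sum_Icc_mul_pow_eq ℓ (fun j => (j : ℝ)) h0.ne'
  simp only [one_mul] at h1
  have h3 : ρ n ^ ℓ ≠ 0 := by positivity
  rw [saddleVariance, h2, ← hn, h1, mul_left_comm, mul_div_mul_left _ _ h3]
  simp

theorem exists_saddle_point {ℓ : ℕ} (hℓ : 1 ≤ ℓ) (n : ℕ) :
    ∃ r : ℝ, 0 ≤ r ∧ ∑ j ∈ Finset.Icc 1 ℓ, r ^ j = n := by
  have hcont : Continuous (fun r : ℝ => ∑ j ∈ Finset.Icc 1 ℓ, r ^ j) := by fun_prop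
  have hn : (0 : ℝ) ≤ n := by positivity
  have h0 : ∑ j ∈ Finset.Icc 1 ℓ, (0 : ℝ) ^ j = 0 := Finset.sum_eq_zero fun j hj => by
    have := (Finset.mem_Icc.1 hj).1
    exact zero_pow (by omega)
  have h1 : (n : ℝ) ≤ ∑ j ∈ Finset.Icc 1 ℓ, (n : ℝ) ^ j := by
    have := Finset.single_le_sum (f := fun j : ℕ => (n : ℝ) ^ j) (fun j _ => by positivity)
      (Finset.mem_Icc.2 ⟨le_rfl, hℓ⟩)
    rwa [pow_one] at this
  obtain ⟨r, hr, hr2⟩ := intermediate_value_Icc hn hcont.continuousOn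
    (show (n : ℝ) ∈ Set.Icc _ _ from ⟨by rw [h0]; exact hn, h1⟩)
  exact ⟨r, hr.1, hr2⟩

theorem exists_tendsto_saddle_point {ℓ : ℕ} (hℓ : 1 ≤ ℓ) :
    ∃ ρ : ℕ → ℝ, Tendsto ρ atTop atTop ∧ ∀ n : ℕ, ∑ j ∈ Finset.Icc 1 ℓ, ρ n ^ j = n := by
  choose ρ hρ0 hρ using exists_saddle_point hℓ
  refine ⟨ρ, tendsto_atTop.2 fun b => ?_, hρ⟩
  filter_upwards [(tendsto_natCast_atTop_atTop (R := ℝ)).eventually_gt_atTop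
    (∑ j ∈ Finset.Icc 1 ℓ, b ^ j)] with n hn
  by_contra hlt
  rw [not_le] at hlt
  have : ∑ j ∈ Finset.Icc 1 ℓ, ρ n ^ j ≤ ∑ j ∈ Finset.Icc 1 ℓ, b ^ j :=
    Finset.sum_le_sum fun j _ => pow_le_pow_left₀ (hρ0 n) hlt.le j
  rw [hρ] at this
  linarith

/-! ### Assembly. -/

theorem saddleCoeff_eq_lagrangeCoeff (k ℓ : ℕ) :
    (saddleCoeff k ℓ : ℝ) = lagrangeCoeff (1 / ℓ) k / ((ℓ : ℝ) - k) := by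
  rw [saddleCoeff, lagrangeCoeff, div_div]
  push_cast
  simp only [mul_one_div]

theorem sum_Icc_two_eq_harmonicReal {ℓ : ℕ} (hℓ : 1 ≤ ℓ) :
    ∑ j ∈ Finset.Icc 2 ℓ, 1 / (j : ℝ) = harmonicReal ℓ - 1 := by
  have : Finset.Icc 1 ℓ = insert 1 (Finset.Icc 2 ℓ) := by
    ext i
    simp only [Finset.mem_Icc, Finset.mem_insert]
    omega
  rw [harmonicReal, this, Finset.sum_insert (by simp)]
  simp

theorem mainTheorem6 (ℓ : ℕ) (hℓ : 1 ≤ ℓ) :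
    (fun n : ℕ => (numBoundedCyclePerms n ℓ : ℝ)) ~[atTop]
      (fun n : ℕ =>
        1 / Real.sqrt (ℓ : ℝ) * (n : ℝ) ^ ((n : ℝ) * (1 - 1 / (ℓ : ℝ))) *
          Real.exp
            (-(1 / (ℓ : ℝ)) * ∑ j ∈ Finset.Icc 2 ℓ, 1 / (j : ℝ)
              - (n : ℝ) + (n : ℝ) / (ℓ : ℝ)
              + ∑ k ∈ Finset.Ico 1 ℓ,
                  (saddleCoeff k ℓ : ℝ) * (n : ℝ) ^ (((ℓ : ℝ) - (k : ℝ)) / (ℓ : ℝ)))) := by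
  have hl : (0 : ℝ) < ℓ := by positivity
  obtain ⟨ρ, hρ, hsaddle⟩ := exists_tendsto_saddle_point hℓ
  have hsaddle' := Eventually.of_forall (f := atTop) hsaddle
  have hcoeff := tendsto_boundedCycleCoeff_saddle hℓ hρ hsaddle'
  have hvar := (Real.continuous_sqrt.tendsto _).comp (tendsto_variance_ratio hℓ hρ hsaddle')
  have hexp := (Real.continuous_exp.tendsto _).comp
    ((tendsto_exponent hℓ hρ hsaddle').add_const ((harmonicReal ℓ - 1) / ℓ))
  rw [neg_add_cancel, Real.exp_zero] at hexp
  rw [Real.sqrt_one] at hvar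
  have hstir := (isEquivalent_iff_tendsto_one (by
    filter_upwards [eventually_gt_atTop 0] with n hn
    have : (0 : ℝ) < n := by exact_mod_cast hn
    positivity)).1 Stirling.factorial_isEquivalent_stirling
  -- The quotient of the two sides is exactly the product of these four quantities, each tending to
  -- 1.
  have hprod := ((hstir.mul hcoeff).mul hvar).mul hexp
  simp only [mul_one] at hprod
  refine isEquivalent_of_tendsto_one (hprod.congr' ?_)
  filter_upwards [eventually_gt_atTop 0, hρ.eventually_gt_atTop 0] with n hn hr
  have hn' : (0 : ℝ) < n := by exact_mod_cast hn
  have hV : 0 < saddleVariance ℓ (ρ n) := hr.trans_le (le_saddleVariance hℓ hr)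
  simp only [Pi.div_apply, Function.comp_apply, saddleCoeff_eq_lagrangeCoeff,
    sum_Icc_two_eq_harmonicReal hℓ]
  rw [numBoundedCyclePerms_eq]
  set σ := ∑ k ∈ Finset.Ico 1 ℓ, lagrangeCoeff (1 / ℓ) k / ((ℓ : ℝ) - k) *
    (n : ℝ) ^ (((ℓ : ℝ) - k) / ℓ) with hσ
  have h1 : (n / Real.exp 1 : ℝ) ^ n = Real.exp (n * Real.log n - n) := by
    rw [div_pow, ← Real.exp_nat_mul, mul_one, Real.exp_sub, Real.exp_nat_mul, Real.exp_log hn']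
  have h2 : ρ n ^ n = Real.exp (n * Real.log (ρ n)) := by
    rw [Real.exp_nat_mul, Real.exp_log hr]
  have h3 : (n : ℝ) ^ ((n : ℝ) * (1 - 1 / ℓ)) =
      Real.exp (Real.log n * (n * (1 - 1 / ℓ))) := Real.rpow_def_of_pos hn' _
  have h4 : √(ℓ * n / saddleVariance ℓ (ρ n)) =
      √ℓ * √n / √(saddleVariance ℓ (ρ n)) := by
    rw [Real.sqrt_div (by positivity), Real.sqrt_mul hl.le]
  have h5 : √(2 * n * Real.pi) = √(2 * Real.pi) * √n := by
    rw [← Real.sqrt_mul (by positivity)]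
    congr 1
    ring
  have h6 : √(2 * Real.pi * saddleVariance ℓ (ρ n)) =
      √(2 * Real.pi) * √(saddleVariance ℓ (ρ n)) := Real.sqrt_mul (by positivity) _
  rw [h1, h2, h3, h4, h5, h6]
  have e : Real.exp (n * Real.log (ρ n)) * Real.exp (-cyclePoly ℓ (ρ n)) *
      Real.exp (cyclePoly ℓ (ρ n) - n * Real.log (ρ n) + n / ℓ * Real.log n - n / ℓ - σ +
        (harmonicReal ℓ - 1) / ℓ) *
      (Real.exp (Real.log n * (n * (1 - 1 / ℓ))) *
        Real.exp (-(1 / ℓ) * (harmonicReal ℓ - 1) - n + n / ℓ + σ)) =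
      Real.exp (n * Real.log n - n) := by
    simp only [← Real.exp_add]
    congr 1
    field_simp
    ring
  have p1 : √(2 * Real.pi) ≠ 0 := by positivity
  have p2 : √(n : ℝ) ≠ 0 := by positivity
  have p3 : √(ℓ : ℝ) ≠ 0 := by positivity
  have p4 : √(saddleVariance ℓ (ρ n)) ≠ 0 := by positivity
  -- With the exponentials and roots as free nonzero variables, what is left is an identity of
  -- rational functions.
  have key : ∀ F a e1 e2 e3 e4 e5 q2 qn ql qv : ℝ, e1 ≠ 0 → e2 ≠ 0 → e3 ≠ 0 → e4 ≠ 0 → e5 ≠ 0 →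
      q2 ≠ 0 → qn ≠ 0 → ql ≠ 0 → qv ≠ 0 →
      F / (q2 * qn * (e1 * e2 * e3 * (e4 * e5))) * (q2 * qv * (a * e1 * e2)) * (ql * qn / qv) * e3 =
        F * a / (1 / ql * e4 * e5) := by
    intros
    field_simp
  rw [← e]
  exact key _ _ _ _ _ _ _ _ _ _ _ (Real.exp_ne_zero _) (Real.exp_ne_zero _) (Real.exp_ne_zero _)
    (Real.exp_ne_zero _) (Real.exp_ne_zero _) p1 p2 p3 p4
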